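/- Let $\mathcal A$ be a unital $*$-subalgebra of $\mathcal B(\mathcal H)$ for a finite-dimensional complex Hilbert space $\mathcal H$, let $\mathcal C=\bigotimes_{k\in\mathbb Z}\mathcal A$ be the spin chain with one-site algebra $\mathcal A$ (the $C^*$-inductive limit of the algebras $\bigotimes_{k\in\Lambda}\mathcal A$, $\Lambda\subset\mathbb Z$ finite and non-empty, under the inclusions $x\mapsto x\otimes\mathbf 1$), and let $\gamma$ be the shift automorphism of $\mathcal C$, which maps the copy of $a\in\mathcal A$ at site $k$ to the copy of $a$ at site $k+1$. A translation-invariant state $\omega$ of $\mathcal C$ (i.e. $\omega\circ\gamma=\omega$) is called ergodic if it is an extreme point of the convex set of translation-invariant states. Let $\mathcal B$ be a finite-dimensional $C^*$-algebra, $\mathcal E:\mathcal A\otimes\mathcal B\to\mathcal B$ a unital completely positive map, and $\rho$ a faithful state on $\mathcal B$ such that $\rho(\mathcal E(\mathbf 1\otimes b))=\rho(b)$ for all $b\in\mathcal B$. For $a\in\mathcal A$ put $\mathcal E_a:\mathcal B\to\mathcal B$, $\mathcal E_a(b):=\mathcal E(a\otimes b)$. Let $\omega$ be the finitely correlated state generated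 by $(\mathcal B,\mathcal E,\rho)$, that is, the translation-invariant state of $\mathcal C$ with $$\omega(a_1\otimes\cdots\otimes a_n)=\rho\bigl(\mathcal E_{a_1}\circ\cdots\circ\mathcal E_{a_n}(\mathbf 1)\bigr)\qquad(n\ge 1,\ a_1,\dots,a_n\in\mathcal A),$$ where $a_1\otimes\cdots\otimes a_n$ is placed at the sites $1,\dots,n$. Assume that $\omega$ is ergodic. Let $a=a^*\in\mathcal A$ be a self-adjoint one-site observable, placed at site $1$, and for $n\ge 1$ let $\mu_{n,a}$ be the distribution of the ergodic average $\bar a_n:=\frac1n\sum_{k=0}^{n-1}\gamma^k(a)$ with respect to $\omega$, i.e. the Borel probability measure on $\mathbb R$ given by $\mu_{n,a}(S)=\omega(\mathbf 1_S(\bar a_n))$, where $\mathbf 1_S(\bar a_n)$ is the spectral projection of $\bar a_n$. For $t\in\mathbb R$ let $r(t)$ be the spectral radius of $\mathcal E_{e^{ta}}:\mathcal B\to\mathcal B$, and let $$I(x):=\sup_{t\in\mathbb R}\{tx-\log r(t)\}\in[0,\infty],\qquad x\in\mathbb R.$$ Then $(\mu_{n,a})_{n\ge1}$ satisfies the large deviation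 principle with the good rate function $I$: the function $I$ is non-negative, convex and lower semicontinuous, its level sets $\{x: I(x)\le c\}$, $c\in\mathbb R$, are compact, and for every Borel set $H\subset\mathbb R$ $$-\inf_{x\in\operatorname{int}H}I(x)\le\liminf_{n\to\infty}\frac1n\log\mu_{n,a}(H)\le\limsup_{n\to\infty}\frac1n\log\mu_{n,a}(H)\le-\inf_{x\in\overline H}I(x).$$ -/

import Mathlib

open scoped TensorProduct ComplexOrder Matrix ENNReal
open MeasureTheory Filter

noncomputable section

namespace SpinChain

/-- The Hilbert space `ℓ²(X)`. -/
abbrev L2 (X : Type*) : Type _ := lp (fun _ : X => ℂ) 2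

theorem summable_sq {X : Type*} (ψ : L2 X) : Summable fun x => ‖ψ x‖ ^ (2 : ℝ≥0∞).toReal :=
  (lp.memℓp ψ).summable (by norm_num)

/-- The unitary `ψ ↦ ψ ∘ e` of `ℓ²(X)` given by a permutation `e` of `X`. -/
def permute {X : Type*} (e : Equiv.Perm X) : L2 X ≃ₗᵢ[ℂ] L2 X where
  toFun ψ := ⟨fun x => ψ (e x), memℓp_gen ((e.summable_iff).2 (summable_sq ψ))⟩
  invFun ψ := ⟨fun x => ψ (e.symm x), memℓp_gen ((e.symm.summable_iff).2 (summable_sq ψ))⟩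
  map_add' _ _ := rfl
  map_smul' _ _ := rfl
  left_inv ψ := by ext x; simp
  right_inv ψ := by ext x; simp
  norm_map' ψ := by
    rw [lp.norm_eq_tsum_rpow (by norm_num), lp.norm_eq_tsum_rpow (by norm_num)]
    congr 1
    exact e.tsum_eq fun x => ‖ψ x‖ ^ (2 : ℝ≥0∞).toReal

/-- The orthogonal projection of `ℓ²(X)` onto the functions supported in `S`. -/
def cut {X : Type*} (S : Set X) : L2 X →L[ℂ] L2 X :=
  LinearMap.mkContinuous
    { toFun := fun ψ => ⟨S.indicator ψ,
        memℓp_gen ((summable_sq ψ).of_nonneg_of_le (fun x => by positivity) fun x => by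
          by_cases h : x ∈ S <;> simp [h])⟩
      map_add' := fun ψ φ => Subtype.ext (Set.indicator_add S ψ φ)
      map_smul' := fun c ψ => Subtype.ext (Set.indicator_const_smul S c ψ) } 1 fun ψ => by
    rw [one_mul]
    refine lp.norm_mono (by norm_num) fun x => ?_
    by_cases h : x ∈ S <;> simp [h]

theorem permute_apply {X : Type*} (e : Equiv.Perm X) (ψ : L2 X) (x : X) :
    permute e ψ x = ψ (e x) := rfl

theorem cut_apply {X : Type*} (S : Set X) (ψ : L2 X) (x : X) :
    cut S ψ x = S.indicator ψ x := rfl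

/-- The permutation of the configurations `σ : ℤ → ι` that exchanges the values `i` and `j`
at the site `k`. -/
def swapAt {ι : Type*} [DecidableEq ι] (k : ℤ) (i j : ι) : Equiv.Perm (ℤ → ι) where
  toFun σ := Function.update σ k (Equiv.swap i j (σ k))
  invFun σ := Function.update σ k (Equiv.swap i j (σ k))
  left_inv σ := by simp
  right_inv σ := by simp

/-- The matrix unit `e_{ij}` placed at the site `k`. -/
def unitAt {ι : Type*} [DecidableEq ι] (k : ℤ) (i j : ι) : L2 (ℤ → ι) →L[ℂ] L2 (ℤ → ι) :=
  cut {σ | σ k = i} ∘L ((permute (swapAt k i j)).toContinuousLinearEquiv : _ →L[ℂ] _)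

/-- The operator on `ℓ²(ι^ℤ)` that acts by the matrix `M` at the site `k` and trivially at all
other sites; see `siteOp_apply` for its explicit form. -/
def siteOp {ι : Type*} [Fintype ι] [DecidableEq ι] (k : ℤ) (M : Matrix ι ι ℂ) : L2 (ℤ → ι) →L[ℂ] L2 (ℤ → ι) :=
  ∑ i, ∑ j, M i j • unitAt k i j

theorem unitAt_apply {ι : Type*} [DecidableEq ι] (k : ℤ) (i j : ι) (ψ : L2 (ℤ → ι)) (σ : ℤ → ι) :
    unitAt k i j ψ σ = if σ k = i then ψ (Function.update σ k j) else 0 := by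
  change Set.indicator _ _ _ = _
  by_cases h : σ k = i
  · simp [h, permute_apply, swapAt]
  · simp [h]

theorem siteOp_apply {ι : Type*} [Fintype ι] [DecidableEq ι] (k : ℤ) (M : Matrix ι ι ℂ) (ψ : L2 (ℤ → ι)) (σ : ℤ → ι) :
    siteOp k M ψ σ = ∑ j, M (σ k) j * ψ (Function.update σ k j) := by
  have h : siteOp k M ψ σ = ∑ i, ∑ j, M i j * unitAt k i j ψ σ := by
    simp only [siteOp, FunLike.coe_sum, Finset.sum_apply, lp.coeFn_sum]
    rfl
  rw [h, Finset.sum_eq_single (σ k)]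
  · simp [unitAt_apply]
  · intro i _ hi
    simp [unitAt_apply, Ne.symm hi]
  · simp

theorem adjoint_unitAt {ι : Type*} [DecidableEq ι] (k : ℤ) (i j : ι) : star (unitAt k i j) = unitAt k j i := by
  rw [ContinuousLinearMap.star_eq_adjoint, eq_comm, ContinuousLinearMap.eq_adjoint_iff]
  intro ψ φ
  rw [lp.inner_eq_tsum, lp.inner_eq_tsum, ← (swapAt k i j).tsum_eq]
  refine tsum_congr fun σ => ?_
  rw [unitAt_apply, unitAt_apply]
  have e : ∀ σ, swapAt k i j σ = Function.update σ k (Equiv.swap i j (σ k)) := fun _ => rfl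
  by_cases h : σ k = i
  · rw [e]; subst h; simp
  · have : ¬ (swapAt k i j σ) k = j := by
      rw [e]; simp [Equiv.swap_apply_eq_iff, h]
    simp [h, this]

/-- The embedding of the matrix algebra at the site `k`, as a unital `*`-homomorphism. -/
def siteHom {ι : Type*} [Fintype ι] [DecidableEq ι] (k : ℤ) : Matrix ι ι ℂ →⋆ₐ[ℂ] (L2 (ℤ → ι) →L[ℂ] L2 (ℤ → ι)) where
  toFun := siteOp k
  map_one' := by
    ext ψ σ
    simp [siteOp_apply, Matrix.one_apply]
  map_mul' M N := by
    ext ψ σ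
    simp only [siteOp_apply, mul_apply_eq_comp, Matrix.mul_apply,
      Function.update_self, Function.update_idem, Finset.sum_mul, Finset.mul_sum]
    rw [Finset.sum_comm]
    simp only [mul_assoc]
  map_zero' := by simp [siteOp]
  map_add' M N := by simp [siteOp, add_smul, Finset.sum_add_distrib]
  commutes' c := by
    ext ψ σ
    simp [siteOp_apply, Matrix.algebraMap_matrix_apply]
  map_star' M := by
    simp only [siteOp, star_sum, star_smul, adjoint_unitAt]
    rw [Finset.sum_comm]
    rfl

/-- The spin chain `⨂_{k ∈ ℤ} A` with one-site algebra `A ⊆ M_ι(ℂ) = B(ℂ^ι)`: the norm closure of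
the `*`-algebra generated by the copies of `A` at all sites, acting on `ℓ²(ι^ℤ)`.

For finite `Λ ⊆ ℤ` the copies of `A` at the sites of `Λ` commute and generate a faithful, hence
isometric, copy of `⨂_{k ∈ Λ} A`; the inclusions between these copies are `a ↦ a ⊗ 1`. The norm
closure of their union is therefore the `C*`-inductive limit of the algebras `⨂_{k ∈ Λ} A`. -/
def chain {ι : Type*} [Fintype ι] [DecidableEq ι] (A : StarSubalgebra ℂ (Matrix ι ι ℂ)) :
    StarSubalgebra ℂ (L2 (ℤ → ι) →L[ℂ] L2 (ℤ → ι)) :=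
  (⨆ k : ℤ, A.map (siteHom k)).topologicalClosure

instance isClosed_chain {ι : Type*} [Fintype ι] [DecidableEq ι]
    (A : StarSubalgebra ℂ (Matrix ι ι ℂ)) :
    IsClosed (chain A : Set (L2 (ℤ → ι) →L[ℂ] L2 (ℤ → ι))) :=
  StarSubalgebra.isClosed_topologicalClosure _

/-- The embedding of the one-site algebra `A` into the spin chain at the site `k`. -/
def site {ι : Type*} [Fintype ι] [DecidableEq ι] (A : StarSubalgebra ℂ (Matrix ι ι ℂ)) (k : ℤ) :
    A →⋆ₐ[ℂ] chain A :=
  ((siteHom k).comp A.subtype).codRestrict (chain A) fun a =>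
    StarSubalgebra.le_topologicalClosure _
      (le_iSup (fun k : ℤ => A.map (siteHom k)) k ⟨a, a.2, rfl⟩)

/-- The permutation `σ ↦ (m ↦ σ (m + 1))` of the configurations. -/
def shiftPerm (ι : Type*) : Equiv.Perm (ℤ → ι) where
  toFun σ m := σ (m + 1)
  invFun σ m := σ (m - 1)
  left_inv σ := by ext m; simp
  right_inv σ := by ext m; simp

/-- The automorphism `x ↦ U x U*` of `B(ℓ²(ι^ℤ))`, where `U` is the translation of configurations. -/
def translate (ι : Type*) :
    (L2 (ℤ → ι) →L[ℂ] L2 (ℤ → ι)) →⋆ₐ[ℂ] (L2 (ℤ → ι) →L[ℂ] L2 (ℤ → ι)) :=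
  ((permute (shiftPerm ι)).conjStarAlgEquiv :
    (L2 (ℤ → ι) →L[ℂ] L2 (ℤ → ι)) →⋆ₐ[ℂ] (L2 (ℤ → ι) →L[ℂ] L2 (ℤ → ι)))

theorem translate_siteHom {ι : Type*} [Fintype ι] [DecidableEq ι] (k : ℤ) (M : Matrix ι ι ℂ) :
    translate ι (siteHom k M) = siteHom (k + 1) M := by
  ext ψ σ
  change siteOp k M ((permute (shiftPerm ι)).symm ψ) (shiftPerm ι σ) = siteOp (k + 1) M ψ σ
  rw [siteOp_apply, siteOp_apply]
  refine Finset.sum_congr rfl fun j _ => ?_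
  have h : (shiftPerm ι).symm (Function.update (shiftPerm ι σ) k j) =
      Function.update σ (k + 1) j := by
    rw [Equiv.symm_apply_eq]
    ext m
    simp [shiftPerm, Function.update_apply]
  exact congrArg (fun τ => M (σ (k + 1)) j * ψ τ) h

theorem translate_mem {ι : Type*} [Fintype ι] [DecidableEq ι]
    (A : StarSubalgebra ℂ (Matrix ι ι ℂ)) {x : L2 (ℤ → ι) →L[ℂ] L2 (ℤ → ι)} (hx : x ∈ chain A) :
    translate ι x ∈ chain A := by
  have hc : Continuous (translate ι) :=
    (continuous_const.clm_comp (continuous_id.clm_comp continuous_const) :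
      Continuous fun x : L2 (ℤ → ι) →L[ℂ] L2 (ℤ → ι) =>
        ((permute (shiftPerm ι)).toContinuousLinearEquiv : L2 (ℤ → ι) →L[ℂ] L2 (ℤ → ι)) ∘L x ∘L
          ((permute (shiftPerm ι)).symm.toContinuousLinearEquiv : L2 (ℤ → ι) →L[ℂ] L2 (ℤ → ι)))
  have h1 : (⨆ k : ℤ, A.map (siteHom k)) ≤
      (⨆ k : ℤ, A.map (siteHom k)).comap (translate ι) := by
    refine iSup_le fun k => ?_
    rintro _ ⟨a, ha, rfl⟩
    change translate ι (siteHom k a) ∈ (⨆ k : ℤ, A.map (siteHom k))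
    rw [translate_siteHom]
    exact le_iSup (fun k : ℤ => A.map (siteHom k)) (k + 1) ⟨a, ha, rfl⟩
  have hx' : x ∈ closure ((⨆ k : ℤ, A.map (siteHom k) : StarSubalgebra ℂ _) : Set _) := hx
  exact map_mem_closure hc hx' fun y hy => h1 hy

/-- The shift automorphism `γ` of the spin chain (as a `*`-homomorphism); it maps the copy of
`a ∈ A` at the site `k` to the copy of `a` at the site `k + 1`. -/
def shift {ι : Type*} [Fintype ι] [DecidableEq ι] (A : StarSubalgebra ℂ (Matrix ι ι ℂ)) :
    chain A →⋆ₐ[ℂ] chain A :=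
  ((translate ι).comp (chain A).subtype).codRestrict (chain A) fun x =>
    translate_mem A x.2

theorem shift_site {ι : Type*} [Fintype ι] [DecidableEq ι] (A : StarSubalgebra ℂ (Matrix ι ι ℂ))
    (k : ℤ) (a : A) : shift A (site A k a) = site A (k + 1) a :=
  Subtype.ext (translate_siteHom k (a : Matrix ι ι ℂ))

/-- States of a unital complex `*`-algebra. -/
structure IsState {C : Type*} [Ring C] [StarRing C] [Algebra ℂ C] (φ : C →ₗ[ℂ] ℂ) : Prop where
  nonneg : ∀ x, 0 ≤ φ (star x * x)
  map_one : φ 1 = 1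

/-- The convex set of translation-invariant states of the spin chain. -/
def invariantStates {ι : Type*} [Fintype ι] [DecidableEq ι]
    (A : StarSubalgebra ℂ (Matrix ι ι ℂ)) : Set (chain A →ₗ[ℂ] ℂ) :=
  {φ | IsState φ ∧ ∀ x, φ (shift A x) = φ x}

/-- Ergodic states: the extreme points of the set of translation-invariant states. -/
def IsErgodic {ι : Type*} [Fintype ι] [DecidableEq ι] (A : StarSubalgebra ℂ (Matrix ι ι ℂ))
    (ω : chain A →ₗ[ℂ] ℂ) : Prop :=
  ω ∈ Set.extremePoints ℝ (invariantStates A)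

/-- Complete positivity: every amplification `M_n(C) → M_n(D)` maps positive elements (those of
the form `y* y`) to positive elements. -/
def IsCompletelyPositive {C D : Type*} [Ring C] [Star C] [Algebra ℂ C] [Ring D] [Star D]
    [Algebra ℂ D] (E : C →ₗ[ℂ] D) : Prop :=
  ∀ (n : ℕ) (Y : Matrix (Fin n) (Fin n) C),
    ∃ Z : Matrix (Fin n) (Fin n) D, (Yᴴ * Y).map E = Zᴴ * Z

/-- `(B, E, ρ)` generates a finitely correlated state on the chain with one-site algebra `A`:
`E : A ⊗ B → B` is unital and completely positive, `ρ` is a faithful state of `B`, and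
`ρ (E (1 ⊗ b)) = ρ b`. -/
structure IsGeneratingTriple {A B : Type*} [Ring A] [StarRing A] [Algebra ℂ A] [StarModule ℂ A]
    [Ring B] [StarRing B] [Algebra ℂ B] [StarModule ℂ B]
    (E : A ⊗[ℂ] B →ₗ[ℂ] B) (ρ : B →ₗ[ℂ] ℂ) : Prop where
  unital : E 1 = 1
  completelyPositive : IsCompletelyPositive E
  isState : IsState ρ
  faithful : ∀ b, ρ (star b * b) = 0 → b = 0
  invariant : ∀ b, ρ (E (1 ⊗ₜ[ℂ] b)) = ρ b

/-- The map `E_a : B → B`, `b ↦ E (a ⊗ b)`. -/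
def partialMap {A B : Type*} [Ring A] [Algebra ℂ A] [Ring B] [Algebra ℂ B]
    (E : A ⊗[ℂ] B →ₗ[ℂ] B) (a : A) : Module.End ℂ B :=
  E ∘ₗ TensorProduct.mk ℂ A B a

/-- `ω` is the finitely correlated state generated by `(B, E, ρ)`: the translation-invariant state
whose restriction to the sites `1, …, n` is given by
`ω (a₁ ⊗ ⋯ ⊗ aₙ) = ρ (E_{a₁} ∘ ⋯ ∘ E_{aₙ} (1))`. -/
structure IsGeneratedBy {ι B : Type*} [Fintype ι] [DecidableEq ι] [Ring B] [Algebra ℂ B]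
    (A : StarSubalgebra ℂ (Matrix ι ι ℂ)) (E : A ⊗[ℂ] B →ₗ[ℂ] B) (ρ : B →ₗ[ℂ] ℂ)
    (ω : chain A →ₗ[ℂ] ℂ) : Prop where
  mem_invariantStates : ω ∈ invariantStates A
  apply_prod : ∀ (n : ℕ) (a : Fin n → A),
    ω (List.ofFn fun i : Fin n => site A ((i : ℤ) + 1) (a i)).prod =
      ρ ((List.ofFn fun i : Fin n => partialMap E (a i)).prod 1)

/-- The ergodic average `(1/n) ∑_{k<n} γ^k(a)`, where `a ∈ A` is placed at the site `1`. -/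
def ergodicAverage {ι : Type*} [Fintype ι] [DecidableEq ι] (A : StarSubalgebra ℂ (Matrix ι ι ℂ))
    (a : A) (n : ℕ) : chain A :=
  (n : ℂ)⁻¹ • ∑ k ∈ Finset.range n, (shift A)^[k] (site A 1 a)

/-- `μ` is the distribution of the observable `x` (with finite spectrum) in the state `ω`:
the probability measure with `μ(S) = ω(1_S(x))` for the Borel sets `S`, where `1_S(x)` is the
spectral projection of `x`. -/
structure IsDistribution {C : Type*} [CStarAlgebra C] (ω : C →ₗ[ℂ] ℂ) (x : C) (μ : Measure ℝ) :
    Prop where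
  isProbabilityMeasure : IsProbabilityMeasure μ
  apply_eq : ∀ S : Set ℝ, MeasurableSet S →
    (μ.real S : ℂ) = ω (cfc (S.indicator fun _ => (1 : ℝ)) x)

/-- Good rate functions on `ℝ`; rate functions are `[0, ∞]`-valued and convex. -/
structure IsGoodRateFunction (I : ℝ → EReal) : Prop where
  nonneg : ∀ x, 0 ≤ I x
  convex : ∀ x y s t : ℝ, 0 ≤ s → 0 ≤ t → s + t = 1 →
    I (s * x + t * y) ≤ (s : EReal) * I x + (t : EReal) * I y
  lowerSemicontinuous : LowerSemicontinuous I
  isCompact : ∀ c : ℝ, IsCompact {x | I x ≤ c}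

/-- The large deviation principle for a sequence of measures on `ℝ` with rate function `I`;
here `ENNReal.log 0 = -∞`. -/
def LargeDeviationPrinciple (μ : ℕ → Measure ℝ) (I : ℝ → EReal) : Prop :=
  ∀ H : Set ℝ, MeasurableSet H →
    -(⨅ x ∈ interior H, I x) ≤
        liminf (fun n : ℕ => (((n : ℝ)⁻¹ : ℝ) : EReal) * ENNReal.log (μ n H)) atTop ∧
      limsup (fun n : ℕ => (((n : ℝ)⁻¹ : ℝ) : EReal) * ENNReal.log (μ n H)) atTop ≤
        -(⨅ x ∈ closure H, I x)

instance isTopologicalRing_starSubalgebra {ι : Type*} [Fintype ι] [DecidableEq ι]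
    (A : StarSubalgebra ℂ (Matrix ι ι ℂ)) : IsTopologicalRing A :=
  inferInstanceAs (IsTopologicalRing A.toSubalgebra.toSubring)

/-- `r(t)`, the spectral radius of the positive map `E_{exp(t a)}`. -/
def expRadius {A B : Type*} [Ring A] [Algebra ℂ A] [TopologicalSpace A] [IsTopologicalRing A]
    [Ring B] [Algebra ℂ B] (E : A ⊗[ℂ] B →ₗ[ℂ] B) (a : A) (t : ℝ) : ℝ :=
  (spectralRadius ℂ (partialMap E (NormedSpace.exp ((t : ℂ) • a)))).toReal

/-- The Legendre-Fenchel transform `I(x) = sup_t (t x - log r(t))`. -/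
def rateFunction {A B : Type*} [Ring A] [Algebra ℂ A] [TopologicalSpace A] [IsTopologicalRing A]
    [Ring B] [Algebra ℂ B] (E : A ⊗[ℂ] B →ₗ[ℂ] B) (a : A) (x : ℝ) : EReal :=
  ⨆ t : ℝ, ((t * x - Real.log (expRadius E a t) : ℝ) : EReal)

end SpinChain

end

/-! Let S_n be the sum of n consecutive copies of a. As a is a real combination of orthogonal
projections in A and copies at different sites commute, S_n has a classical law in ω, and its
exponential moment is ρ(Φⁿ 1) with Φ = E_{exp(ta)}, a positive map. On positive elements of a
finite-dimensional algebra a faithful state is comparable with the norm, so Gelfand's formula makes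
(1/n) log ρ(Φⁿ 1) tend to log r(t) (`tendsto_log_div_spectralRadius`). The upper bound is then
Chernoff's inequality plus compactness, S_n / n being bounded.

The lower bound uses no differentiability of log r. Extremality of ω gives clustering in the mean
(`tendsto_cesaro_of_extreme`), and finite dimension of B makes it uniform: for one fixed K, summed
over gaps k < K, the joint probability of two block events is at least a constant times the product
of their probabilities (`exists_mixing`). The individual gap is not controlled, but the increments
are bounded, so it is absorbed by widening the windows (`exists_isMixingFamily`).

Gluing blocks makes the set of (x, s) with P(S_n / n ≈ x) ≥ exp(-n s), up to small errors, closed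
and convex. A pigeonhole argument and repetition of one good block show that for every t this set
meets the line s = t x - log r(t). By Hahn-Banach it contains every (x, s) with s ≥ I(x)
(`mem_epigraph`). -/

namespace SpinChain

/-! ### Windows and processes with almost independent blocks -/

/-- The indicator function of the interval `[α - β, α + β]`. -/
noncomputable def window (α β : ℝ) : ℝ → ℝ := (Set.Icc (α - β) (α + β)).indicator 1

theorem window_of_abs_le {α β s : ℝ} (h : |s - α| ≤ β) : window α β s = 1 := by
  rw [abs_le] at h
  exact Set.indicator_of_mem (show s ∈ Set.Icc _ _ from ⟨by linarith, by linarith⟩) _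

theorem window_of_lt_abs {α β s : ℝ} (h : β < |s - α|) : window α β s = 0 := by
  refine Set.indicator_of_notMem (fun hs => ?_) _
  have : |s - α| ≤ β := abs_le.2 ⟨by linarith [hs.1], by linarith [hs.2]⟩
  linarith

theorem window_nonneg (α β s : ℝ) : 0 ≤ window α β s :=
  Set.indicator_nonneg (fun _ _ => zero_le_one) _

theorem window_le_one (α β s : ℝ) : window α β s ≤ 1 := by
  rcases le_or_gt |s - α| β with h | h
  · rw [window_of_abs_le h]
  · rw [window_of_lt_abs h]; exact zero_le_one

theorem window_mono {α β α' β' : ℝ} (h : |α - α'| + β ≤ β') (s : ℝ) :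
    window α β s ≤ window α' β' s := by
  rcases le_or_gt |s - α| β with hs | hs
  · rw [window_of_abs_le hs, window_of_abs_le]
    have : |s - α'| ≤ |s - α| + |α - α'| := by
      simpa using abs_add_le (s - α) (α - α')
    linarith
  · rw [window_of_lt_abs hs]; exact window_nonneg _ _ _

/-- The laws (as positive functionals) of the partial sums of a process with increments bounded by
`D`, whose distant blocks are bounded below, up to a constant, by independent blocks. -/
structure IsMixingFamily (m : ℕ → (ℝ → ℝ) →ₗ[ℝ] ℝ) (D : ℝ) (K : ℕ) (c : ℝ) : Prop where
  pos_bound : 0 < D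
  pos_const : 0 < c
  mono : ∀ (n : ℕ) (f g : ℝ → ℝ), (∀ s, |s| ≤ n * D → f s ≤ g s) → m n f ≤ m n g
  one : ∀ n, m n 1 = 1
  super : ∀ (n n' : ℕ) (α α' β β' : ℝ), c * m n (window α β) * m n' (window α' β') ≤
    m (n + n' + K) (window (α + α') (β + β' + K * D))
  pad : ∀ (n k : ℕ) (α β : ℝ), m n (window α β) ≤ m (n + k) (window α (β + k * D))

namespace IsMixingFamily

variable {m : ℕ → (ℝ → ℝ) →ₗ[ℝ] ℝ} {D c : ℝ} {K : ℕ}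

theorem window_nonneg (h : IsMixingFamily m D K c) (n : ℕ) (α β : ℝ) : 0 ≤ m n (window α β) := by
  simpa using h.mono n 0 (window α β) fun s _ => SpinChain.window_nonneg α β s

theorem window_le_one (h : IsMixingFamily m D K c) (n : ℕ) (α β : ℝ) : m n (window α β) ≤ 1 := by
  rw [← h.one n]
  exact h.mono n _ _ fun s _ => SpinChain.window_le_one α β s

/-- At n = 0 monotonicity only sees s = 0, so a window at the origin has full mass; gluing two empty
blocks then bounds c by a probability. -/
theorem const_le_one (h : IsMixingFamily m D K c) : c ≤ 1 := by
  have h0 : m 0 (window 0 0) = 1 := by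
    refine le_antisymm (h.window_le_one _ _ _) ?_
    rw [← h.one 0]
    refine h.mono 0 _ _ fun s hs => ?_
    rw [window_of_abs_le (by simpa using hs)]
    rfl
  have := h.super 0 0 0 0 0 0
  rw [h0] at this
  have h1 := h.window_le_one (0 + 0 + K) (0 + 0) (0 + 0 + K * D)
  linarith

/-- Iteration of `super`: each further block costs one factor c, one gap of K sites and a widening
by K * D. -/
theorem block_pow_le (h : IsMixingFamily m D K c) (n : ℕ) (α β : ℝ) (M : ℕ) :
    (c * m n (window α β)) ^ M ≤ m (M * (n + K)) (window (M * α) (M * (β + K * D))) := by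
  induction M with
  | zero =>
    rw [pow_zero, zero_mul, ← h.one 0]
    refine h.mono 0 _ _ fun s hs => ?_
    rw [window_of_abs_le (by simpa using hs)]
    rfl
  | succ M ih =>
    have h1 := h.super (M * (n + K)) n (M * α) α (M * (β + K * D)) β
    have e1 : M * (n + K) + n + K = (M + 1) * (n + K) := by ring
    have e2 : (M : ℝ) * α + α = ((M + 1 : ℕ) : ℝ) * α := by push_cast; ring
    have e3 : (M : ℝ) * (β + K * D) + β + K * D = ((M + 1 : ℕ) : ℝ) * (β + K * D) := by
      push_cast; ring
    rw [e1, e2, e3] at h1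
    refine le_trans ?_ h1
    rw [pow_succ]
    calc (c * m n (window α β)) ^ M * (c * m n (window α β))
        ≤ m (M * (n + K)) (window (M * α) (M * (β + K * D))) * (c * m n (window α β)) :=
          mul_le_mul_of_nonneg_right ih (mul_nonneg h.pos_const.le (h.window_nonneg _ _ _))
      _ = _ := by ring

/-! ### The local rate function and convexity of its epigraph -/

/-- The epigraph of the local rate function: the pairs `(x, s)` such that the probability of
being close to `x` is at least of exponential order `exp (-n s)`. -/
def epigraph (m : ℕ → (ℝ → ℝ) →ₗ[ℝ] ℝ) : Set (ℝ × ℝ) :=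
  {q | ∀ δ > 0, ∀ ε > 0, ∀ᶠ n : ℕ in atTop,
    Real.exp (-(n * (q.2 + ε))) ≤ m n (window (n * q.1) (n * δ))}

theorem isClosed_epigraph (h : IsMixingFamily m D K c) : IsClosed (epigraph m) := by
  refine isClosed_of_closure_subset fun q hq δ hδ ε hε => ?_
  obtain ⟨q', hq', hd⟩ := Metric.mem_closure_iff.1 hq (min (δ / 2) (ε / 2)) (by positivity)
  have h1 : |q.1 - q'.1| < δ / 2 :=
    lt_of_le_of_lt (le_max_left _ _) (lt_of_lt_of_le hd (min_le_left _ _))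
  have h2 : |q.2 - q'.2| < ε / 2 :=
    lt_of_le_of_lt (le_max_right _ _) (lt_of_lt_of_le hd (min_le_right _ _))
  filter_upwards [hq' (δ / 2) (by positivity) (ε / 2) (by positivity)] with n hn
  rw [abs_lt] at h2
  have hn0 : (0 : ℝ) ≤ n := Nat.cast_nonneg n
  refine le_trans (Real.exp_le_exp.2 ?_) (hn.trans (h.mono _ _ _ fun s _ => window_mono ?_ s))
  · have : (n : ℝ) * (q'.2 + ε / 2) ≤ n * (q.2 + ε) :=
      mul_le_mul_of_nonneg_left (by linarith) hn0
    linarith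
  · rw [← mul_sub, abs_mul, abs_of_nonneg hn0, abs_sub_comm, ← mul_add]
    exact mul_le_mul_of_nonneg_left (by linarith) hn0

theorem epigraph_upward {q : ℝ × ℝ} (hq : q ∈ epigraph m) {s : ℝ} (hs : q.2 ≤ s) :
    (q.1, s) ∈ epigraph m := by
  intro δ hδ ε hε
  filter_upwards [hq δ hδ ε hε] with n hn
  refine le_trans (Real.exp_le_exp.2 ?_) hn
  have : (n : ℝ) * (q.2 + ε) ≤ n * (s + ε) :=
    mul_le_mul_of_nonneg_left (by linarith) (Nat.cast_nonneg n)
  simpa using this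

theorem epigraph_nonneg (h : IsMixingFamily m D K c) {q : ℝ × ℝ} (hq : q ∈ epigraph m) :
    0 ≤ q.2 := by
  refine le_of_forall_pos_le_add fun ε hε => ?_
  obtain ⟨n, hn, hn0⟩ := ((hq 1 one_pos ε hε).and (eventually_gt_atTop 0)).exists
  have h1 := hn.trans (h.window_le_one _ _ _)
  rw [Real.exp_le_one_iff] at h1
  have h2 : (0 : ℝ) < n := by exact_mod_cast hn0
  by_contra! hc
  nlinarith

/-- A block of about a N sites with mean near q.1 is glued to one of about b N sites with mean near
q'.1; the exponents add up with weights a and b. The factor c, the gap and the rounding are of lower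
order and go into the slack δ, ε. -/
theorem convex_epigraph (h : IsMixingFamily m D K c) : Convex ℝ (epigraph m) := by
  refine convex_iff_forall_pos.2 fun q hq q' hq' a b ha hb hab => ?_
  intro δ hδ ε hε
  have hD := h.pos_bound
  have hc := h.pos_const
  -- lengths of the two blocks
  set n₁ : ℕ → ℕ := fun N => ⌊a * (N - K : ℝ)⌋₊ with hn₁
  set n₂ : ℕ → ℕ := fun N => ⌊b * (N - K : ℝ)⌋₊ with hn₂
  have hcast : Tendsto (fun N : ℕ => (N - K : ℝ)) atTop atTop :=
    tendsto_atTop_add_const_right _ _ tendsto_natCast_atTop_atTop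
  have t₁ : Tendsto n₁ atTop atTop := tendsto_nat_floor_atTop.comp (hcast.const_mul_atTop ha)
  have t₂ : Tendsto n₂ atTop atTop := tendsto_nat_floor_atTop.comp (hcast.const_mul_atTop hb)
  have e₁ := t₁.eventually (hq (δ / 2) (by positivity) (ε / 2) (by positivity))
  have e₂ := t₂.eventually (hq' (δ / 2) (by positivity) (ε / 2) (by positivity))
  -- The numerator collects the drift of the centre, at most (K + 1) * (|q.1| + |q'.1|), and the
  -- widenings K * D from `super` and 2 * D from `pad`.
  have e₃ := tendsto_natCast_atTop_atTop (R := ℝ) |>.eventually_ge_atTop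
    (((K + 1) * (|q.1| + |q'.1|) + (K + 2) * D) / (δ / 2))
  have e₄ := tendsto_natCast_atTop_atTop (R := ℝ) |>.eventually_ge_atTop (-Real.log c / (ε / 2))
  filter_upwards [e₁, e₂, e₃, e₄, eventually_ge_atTop K] with N h₁ h₂ h₃ h₄ h₅
  have hNK : (0 : ℝ) ≤ N - K := by
    have : (K : ℝ) ≤ N := by exact_mod_cast h₅
    linarith
  have l₁ : (n₁ N : ℝ) ≤ a * (N - K) := Nat.floor_le (mul_nonneg ha.le hNK)
  have l₂ : (n₂ N : ℝ) ≤ b * (N - K) := Nat.floor_le (mul_nonneg hb.le hNK)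
  have u₁ : a * (N - K) < n₁ N + 1 := Nat.lt_floor_add_one _
  have u₂ : b * (N - K) < n₂ N + 1 := Nat.lt_floor_add_one _
  have hK0 : (0 : ℝ) ≤ K := Nat.cast_nonneg K
  have ha1 : a ≤ 1 := by linarith
  have hb1 : b ≤ 1 := by linarith
  have haK : a * K ≤ K := mul_le_of_le_one_left hK0 ha1
  have hbK : b * K ≤ K := mul_le_of_le_one_left hK0 hb1
  have haK0 : 0 ≤ a * K := mul_nonneg ha.le hK0
  have hbK0 : 0 ≤ b * K := mul_nonneg hb.le hK0
  have hsum : a * ((N : ℝ) - K) + b * (N - K) = N - K := by rw [← add_mul, hab, one_mul]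
  have hle : n₁ N + n₂ N + K ≤ N := by
    have : ((n₁ N + n₂ N + K : ℕ) : ℝ) ≤ N := by push_cast; linarith
    exact_mod_cast this
  obtain ⟨r, hr⟩ := Nat.exists_eq_add_of_le hle
  have hr2 : (r : ℝ) ≤ 2 := by
    have : (N : ℝ) = n₁ N + n₂ N + K + r := by exact_mod_cast hr
    linarith
  have key := (h.super (n₁ N) (n₂ N) (n₁ N * q.1) (n₂ N * q'.1) (n₁ N * (δ / 2))
    (n₂ N * (δ / 2))).trans (h.pad _ r _ _)
  rw [← hr] at key
  have hN0 : (0 : ℝ) ≤ N := Nat.cast_nonneg N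
  have hq0 := h.epigraph_nonneg hq
  have hq0' := h.epigraph_nonneg hq'
  have hm := mul_le_mul h₁ h₂ (Real.exp_pos _).le (h.window_nonneg _ _ _)
  rw [← Real.exp_add] at hm
  have hm' := mul_le_mul_of_nonneg_left hm hc.le
  rw [← mul_assoc] at hm'
  refine le_trans ?_ (hm'.trans (key.trans (h.mono _ _ _ fun s _ => window_mono ?_ s)))
  · nth_rewrite 1 [← Real.exp_log hc]
    rw [← Real.exp_add, Real.exp_le_exp]
    rw [div_le_iff₀ (by positivity)] at h₄
    have i₁ : (n₁ N : ℝ) * (q.2 + ε / 2) ≤ a * N * (q.2 + ε / 2) :=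
      mul_le_mul_of_nonneg_right (by linarith) (by linarith)
    have i₂ : (n₂ N : ℝ) * (q'.2 + ε / 2) ≤ b * N * (q'.2 + ε / 2) :=
      mul_le_mul_of_nonneg_right (by linarith) (by linarith)
    have i₃ : a * N * (ε / 2) + b * N * (ε / 2) = N * (ε / 2) := by
      rw [← add_mul, ← add_mul, hab, one_mul]
    simp only [Prod.snd_add, Prod.smul_snd, smul_eq_mul]
    linarith
  · rw [div_le_iff₀ (by positivity)] at h₃
    simp only [Prod.fst_add, Prod.smul_fst, smul_eq_mul]
    have d₁ : |(n₁ N : ℝ) - N * a| ≤ K + 1 := by rw [abs_le]; constructor <;> linarith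
    have d₂ : |(n₂ N : ℝ) - N * b| ≤ K + 1 := by rw [abs_le]; constructor <;> linarith
    have d₃ : |n₁ N * q.1 + n₂ N * q'.1 - N * (a * q.1 + b * q'.1)| ≤
        (K + 1) * (|q.1| + |q'.1|) := by
      have : n₁ N * q.1 + n₂ N * q'.1 - N * (a * q.1 + b * q'.1) =
        (n₁ N - N * a) * q.1 + (n₂ N - N * b) * q'.1 := by ring
      rw [this, mul_add]
      refine (abs_add_le _ _).trans (add_le_add ?_ ?_) <;> rw [abs_mul]
      · exact mul_le_mul_of_nonneg_right d₁ (abs_nonneg _)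
      · exact mul_le_mul_of_nonneg_right d₂ (abs_nonneg _)
    have d₄ : (r : ℝ) * D ≤ 2 * D := mul_le_mul_of_nonneg_right hr2 hD.le
    have d₅ : (n₁ N : ℝ) * (δ / 2) + n₂ N * (δ / 2) ≤ N * (δ / 2) := by
      rw [← add_mul]
      exact mul_le_mul_of_nonneg_right (by linarith) (by positivity)
    linarith

/-! ### Lower bound: exponential moments, pigeonhole and separation -/

theorem exp_le (h : IsMixingFamily m D K c) (n : ℕ) (t : ℝ) :
    Real.exp (-(n * (|t| * D))) ≤ m n fun s => Real.exp (t * s) := by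
  have h1 : m n (Real.exp (-(n * (|t| * D))) • (1 : ℝ → ℝ)) ≤ m n fun s => Real.exp (t * s) := by
    refine h.mono _ _ _ fun s hs => ?_
    simp only [Pi.smul_apply, Pi.one_apply, smul_eq_mul, mul_one, Real.exp_le_exp]
    have h2 := neg_abs_le (t * s)
    rw [abs_mul] at h2
    have h3 := mul_le_mul_of_nonneg_left hs (abs_nonneg t)
    linarith
  rwa [map_smul, h.one, smul_eq_mul, mul_one] at h1

/-- The moment, of order exp(n Λ), is carried by finitely many windows covering [-D, D], so at one
large length n some window around n x has probability about exp(-n (t x - Λ)). Repeating this block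
by `block_pow_le` carries the estimate to all large N with the same x. -/
theorem exists_window_ge (h : IsMixingFamily m D K c) {t Λ : ℝ}
    (hΛ : Tendsto (fun n : ℕ => Real.log (m n fun s => Real.exp (t * s)) / n) atTop (nhds Λ))
    {δ : ℝ} (hδ : 0 < δ) : ∃ x ∈ Set.Icc (-D) D, ∀ᶠ N : ℕ in atTop,
      Real.exp (-(N * (t * x - Λ + (|t| + 4) * δ))) ≤ m N (window (N * x) (N * (3 * δ))) := by
  have hD := h.pos_bound
  have hc := h.pos_const
  obtain ⟨T, hT, hTf, hcov⟩ := (isCompact_Icc (a := -D) (b := D)).finite_cover_balls hδ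
  obtain ⟨T, rfl⟩ := hTf.exists_finset_coe
  have hcast := tendsto_natCast_atTop_atTop (R := ℝ)
  have e₁ := hΛ.eventually (lt_mem_nhds (show Λ - δ < Λ by linarith))
  have e₂ := hcast.eventually_ge_atTop (Real.log (T.card + 1) / δ)
  have e₃ := hcast.eventually_ge_atTop (-Real.log c / δ)
  have e₄ := hcast.eventually_ge_atTop (2 * K * D / δ)
  obtain ⟨n, h₁, h₂, h₃, h₄, hn0⟩ :=
    (e₁.and (e₂.and (e₃.and (e₄.and (eventually_gt_atTop 0))))).exists
  have hn : (0 : ℝ) < n := by exact_mod_cast hn0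
  rw [div_le_iff₀ hδ] at h₂ h₃ h₄
  rw [lt_div_iff₀ hn] at h₁
  have hbound : (m n fun s => Real.exp (t * s)) ≤
      ∑ y ∈ T, Real.exp (n * (t * y + |t| * δ)) * m n (window (n * y) (n * δ)) := by
    have : ∑ y ∈ T, Real.exp (n * (t * y + |t| * δ)) * m n (window (n * y) (n * δ)) =
        m n (∑ y ∈ T, Real.exp (n * (t * y + |t| * δ)) • window (n * y) (n * δ)) := by
      simp [map_sum]
    rw [this]
    refine h.mono _ _ _ fun s hs => ?_
    have hs' : s / n ∈ Set.Icc (-D) D := by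
      rw [abs_le] at hs
      rw [Set.mem_Icc, le_div_iff₀ hn, div_le_iff₀ hn]
      constructor <;> linarith
    obtain ⟨y, hy, hys⟩ := Set.mem_iUnion₂.1 (hcov hs')
    rw [Metric.mem_ball, Real.dist_eq] at hys
    have hys' : |s - n * y| ≤ n * δ := by
      have : s - n * y = n * (s / n - y) := by field_simp
      rw [this, abs_mul, abs_of_pos hn]
      exact mul_le_mul_of_nonneg_left hys.le hn.le
    rw [Finset.sum_apply]
    refine le_trans ?_ (Finset.single_le_sum (f := fun y =>
      (Real.exp (n * (t * y + |t| * δ)) • window (n * y) (n * δ)) s) (fun z _ =>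
        mul_nonneg (Real.exp_pos _).le (SpinChain.window_nonneg _ _ _)) hy)
    simp only [Pi.smul_apply, smul_eq_mul, window_of_abs_le hys', mul_one]
    rw [Real.exp_le_exp]
    have : t * (s - n * y) ≤ |t| * (n * δ) :=
      (le_abs_self _).trans (by rw [abs_mul]; exact mul_le_mul_of_nonneg_left hys' (abs_nonneg _))
    linarith
  have hmpos : 0 < m n fun s => Real.exp (t * s) := (Real.exp_pos _).trans_le (h.exp_le n t)
  have hlow : Real.exp ((Λ - δ) * n) ≤ m n fun s => Real.exp (t * s) := by
    rw [← Real.exp_log hmpos]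
    exact Real.exp_le_exp.2 h₁.le
  -- The additional 1 makes the contradiction in the pigeonhole step strict.
  have hcard : (T.card + 1 : ℝ) ≤ Real.exp (n * δ) := by
    rw [← Real.exp_log (show (0 : ℝ) < T.card + 1 by positivity)]
    exact Real.exp_le_exp.2 h₂
  -- one of the windows carries its share of the mass
  obtain ⟨x, hx, hxm⟩ : ∃ x ∈ T, Real.exp (-(n * (t * x - Λ + |t| * δ + 2 * δ))) ≤
      m n (window (n * x) (n * δ)) := by
    by_contra! hcon
    have : ∑ y ∈ T, Real.exp (n * (t * y + |t| * δ)) * m n (window (n * y) (n * δ)) ≤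
        ∑ y ∈ T, Real.exp (n * (Λ - 2 * δ)) := by
      refine Finset.sum_le_sum fun y hy => ?_
      refine (mul_le_mul_of_nonneg_left (hcon y hy).le (Real.exp_pos _).le).trans ?_
      rw [← Real.exp_add, Real.exp_le_exp]
      linarith
    rw [Finset.sum_const, nsmul_eq_mul] at this
    have h5 := hlow.trans (hbound.trans this)
    have h6 : Real.exp ((Λ - δ) * n) = Real.exp (n * δ) * Real.exp (n * (Λ - 2 * δ)) := by
      rw [← Real.exp_add]; ring_nf
    rw [h6] at h5
    have h7 := le_of_mul_le_mul_right h5 (Real.exp_pos _)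
    linarith
  have hxD := hT hx
  have hxa : |x| ≤ D := abs_le.2 hxD
  refine ⟨x, hxD, ?_⟩
  set e : ℝ := t * x - Λ + |t| * δ + 3 * δ with he
  have hce : Real.exp (-(n * e)) ≤ c * m n (window (n * x) (n * δ)) := by
    refine le_trans ?_ (mul_le_mul_of_nonneg_left hxm hc.le)
    nth_rewrite 1 [← Real.exp_log hc]
    rw [← Real.exp_add, Real.exp_le_exp]
    linarith
  -- The sign matters below, where the exponent M * n * e is enlarged to N * e.
  have he0 : 0 ≤ e := by
    have h5 : Real.exp (-(n * e)) ≤ 1 := hce.trans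
      (mul_le_one₀ h.const_le_one (h.window_nonneg _ _ _) (h.window_le_one _ _ _))
    rw [Real.exp_le_one_iff] at h5
    by_contra! h6
    nlinarith
  -- With N = M (n + K) + r, the drift of the centre is at most (M K + r) D, and gaps and padding
  -- widen the window by the same amount. The part 2 M K D is at most N δ by the choice of n, the
  -- part 2 r D by the choice of N; with the original width M n δ this gives 3 N δ.
  have e₅ := hcast.eventually_ge_atTop (2 * (n + K) * D / δ)
  filter_upwards [e₅] with N h₅
  rw [div_le_iff₀ hδ] at h₅
  set M := N / (n + K) with hM
  set r := N % (n + K) with hr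
  have hN : M * (n + K) + r = N := Nat.div_add_mod' _ _
  have hr' : r ≤ n + K := (Nat.mod_lt _ (by omega)).le
  have hNr : (N : ℝ) = M * (n + K) + r := by exact_mod_cast hN.symm
  have hrr : (r : ℝ) ≤ n + K := by exact_mod_cast hr'
  have hr0 : (0 : ℝ) ≤ r := Nat.cast_nonneg r
  have hM0 : (0 : ℝ) ≤ M := Nat.cast_nonneg M
  have hK0 : (0 : ℝ) ≤ K := Nat.cast_nonneg K
  have key := (h.block_pow_le n (n * x) (n * δ) M).trans (h.pad _ r _ _)
  rw [hN] at key
  have hMn : (M : ℝ) * n ≤ N := by nlinarith [mul_nonneg hM0 hK0]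
  refine le_trans ?_ (key.trans (h.mono _ _ _ fun s _ => window_mono ?_ s))
  · refine le_trans ?_ (pow_le_pow_left₀ (Real.exp_pos _).le hce M)
    rw [← Real.exp_nat_mul, Real.exp_le_exp]
    have h6 : (M : ℝ) * n * e ≤ N * e := mul_le_mul_of_nonneg_right hMn he0
    have h7 : (N : ℝ) * e ≤ N * (t * x - Λ + (|t| + 4) * δ) :=
      mul_le_mul_of_nonneg_left (by rw [he]; linarith) (Nat.cast_nonneg N)
    linarith
  · have h8 : |(M : ℝ) * (n * x) - N * x| ≤ (M * K + r) * D := by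
      have : (M : ℝ) * (n * x) - N * x = -((M * K + r) * x) := by rw [hNr]; ring
      rw [this, abs_neg, abs_mul, abs_of_nonneg (by positivity)]
      exact mul_le_mul_of_nonneg_left hxa (by positivity)
    have h9 : (M : ℝ) * (2 * K * D) ≤ M * (n * δ) := mul_le_mul_of_nonneg_left h₄ hM0
    have h10 : (M : ℝ) * n * δ ≤ N * δ := mul_le_mul_of_nonneg_right hMn hδ.le
    have h11 : (r : ℝ) * D ≤ (n + K) * D := mul_le_mul_of_nonneg_right hrr hD.le
    linarith

/-- The centres found for δ = 1 / (k + 1) stay in [-D, D]; a limit point works because membership in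
the epigraph leaves slack in both coordinates. -/
theorem exists_mem_epigraph (h : IsMixingFamily m D K c) {t Λ : ℝ}
    (hΛ : Tendsto (fun n : ℕ => Real.log (m n fun s => Real.exp (t * s)) / n) atTop (nhds Λ)) :
    ∃ x, (x, t * x - Λ) ∈ epigraph m := by
  choose x hxD hx using fun k : ℕ => h.exists_window_ge hΛ (δ := 1 / ((k : ℝ) + 1)) (by positivity)
  obtain ⟨y, -, φ, hφ, hy⟩ := (isCompact_Icc (a := -D) (b := D)).tendsto_subseq hxD
  refine ⟨y, fun δ hδ ε hε => ?_⟩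
  have hz : Tendsto (fun k : ℕ => 1 / ((φ k : ℝ) + 1)) atTop (nhds 0) :=
    tendsto_one_div_add_atTop_nhds_zero_nat.comp hφ.tendsto_atTop
  have t₁ : Tendsto (fun k => t * x (φ k) - Λ + (|t| + 4) * (1 / ((φ k : ℝ) + 1))) atTop
      (nhds (t * y - Λ + (|t| + 4) * 0)) :=
    ((hy.const_mul t).sub_const Λ).add (hz.const_mul _)
  have t₂ : Tendsto (fun k => |x (φ k) - y| + 3 * (1 / ((φ k : ℝ) + 1))) atTop
      (nhds (|y - y| + 3 * 0)) := (hy.sub_const y).abs.add (hz.const_mul _)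
  obtain ⟨k, h₁, h₂⟩ := ((t₁.eventually (gt_mem_nhds (show _ < t * y - Λ + ε by linarith))).and
    (t₂.eventually (gt_mem_nhds (show _ < δ by simpa using hδ)))).exists
  filter_upwards [hx (φ k)] with N hN
  have hN0 : (0 : ℝ) ≤ N := Nat.cast_nonneg N
  refine le_trans (Real.exp_le_exp.2 ?_) (hN.trans (h.mono _ _ _ fun s _ => window_mono ?_ s))
  · exact neg_le_neg (mul_le_mul_of_nonneg_left h₁.le hN0)
  · rw [← mul_sub, abs_mul, abs_of_nonneg hN0, ← mul_add]
    exact mul_le_mul_of_nonneg_left h₂.le hN0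

/-- The lower bound of the large deviation principle: the Legendre transform of `Λ` lies above
the local rate function. -/
theorem mem_epigraph (h : IsMixingFamily m D K c) {Λ : ℝ → ℝ}
    (hΛ : ∀ t, Tendsto (fun n : ℕ => Real.log (m n fun s => Real.exp (t * s)) / n) atTop
      (nhds (Λ t))) {x s : ℝ} (hs : ∀ t, t * x - Λ t ≤ s) : (x, s) ∈ epigraph m := by
  by_contra hcon
  obtain ⟨f, u, hf, hu⟩ := geometric_hahn_banach_closed_point h.convex_epigraph
    h.isClosed_epigraph hcon
  set τ := f (1, 0) with hτ
  set κ := f (0, 1) with hκ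
  have hfe : ∀ y r : ℝ, f (y, r) = τ * y + κ * r := fun y r => by
    have : ((y, r) : ℝ × ℝ) = y • ((1 : ℝ), (0 : ℝ)) + r • ((0 : ℝ), (1 : ℝ)) := by simp
    rw [this, map_add, map_smul, map_smul, smul_eq_mul, smul_eq_mul, mul_comm y, mul_comm r]
  rw [hfe] at hu
  -- The epigraph is closed upwards in the second coordinate, so a functional bounded above on it
  -- cannot increase there.
  have hκ0 : κ ≤ 0 := by
    obtain ⟨y, hy⟩ := h.exists_mem_epigraph (hΛ 0)
    by_contra! hκ0
    set R := max (0 * y - Λ 0) ((u - τ * y) / κ) with hR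
    have h1 := hf _ (epigraph_upward hy (s := R) (le_max_left _ _))
    rw [hfe] at h1
    have h2 : (u - τ * y) / κ ≤ R := le_max_right _ _
    rw [div_le_iff₀ hκ0] at h2
    linarith
  rcases hκ0.lt_or_eq with hκ1 | hκ1
  -- A non-vertical separating line has slope t = τ / -κ; it would have to pass strictly between (x,
  -- s) and the epigraph point on s = t x - Λ t, although s ≥ t x - Λ t.
  · obtain ⟨y, hy⟩ := h.exists_mem_epigraph (hΛ (τ / -κ))
    have h1 := hf _ hy
    rw [hfe] at h1
    have h2 := hs (τ / -κ)
    have h3 : κ * (τ / -κ) = -τ := by rw [div_neg, mul_neg, mul_div_cancel₀ _ hκ1.ne]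
    have h4 : κ * s ≤ κ * (τ / -κ * x - Λ (τ / -κ)) := mul_le_mul_of_nonpos_left h2 hκ0
    have h5 : κ * (τ / -κ * x - Λ (τ / -κ)) = -τ * x - κ * Λ (τ / -κ) := by rw [← h3]; ring
    have h6 : κ * (τ / -κ * y - Λ (τ / -κ)) = -τ * y - κ * Λ (τ / -κ) := by rw [← h3]; ring
    linarith
  -- A vertical separating line gives τ y < u < τ x for all y in the domain. At slope R τ the
  -- epigraph point y has R τ y - Λ (R τ) ≥ 0, hence s ≥ R τ (x - y) ≥ R (τ x - u), which is at
  -- least s + 1 for this R.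
  · rw [hκ1, zero_mul, add_zero] at hu
    have hpos : 0 < τ * x - u := by linarith
    set R := max 1 ((s + 1) / (τ * x - u)) with hR
    have hR0 : 0 < R := lt_of_lt_of_le one_pos (le_max_left _ _)
    have hR1 : (s + 1) / (τ * x - u) ≤ R := le_max_right _ _
    rw [div_le_iff₀ hpos] at hR1
    obtain ⟨y, hy⟩ := h.exists_mem_epigraph (hΛ (R * τ))
    have h1 := hf _ hy
    rw [hfe, hκ1, zero_mul, add_zero] at h1
    have h2 := h.epigraph_nonneg hy
    have h3 := hs (R * τ)
    simp only at h2
    nlinarith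

/-! ### Upper bound: Chernoff's inequality with finitely many slopes -/

/-- The upper bound of the large deviation principle for closed sets. -/
theorem eventually_indicator_le (h : IsMixingFamily m D K c) {Λ : ℝ → ℝ}
    (hΛ : ∀ t, Tendsto (fun n : ℕ => Real.log (m n fun s => Real.exp (t * s)) / n) atTop
      (nhds (Λ t))) {F : Set ℝ} (hF : IsClosed F) {b : ℝ} (hb : ∀ x ∈ F, ∃ t, b < t * x - Λ t)
    {ε : ℝ} (hε : 0 < ε) :
    ∀ᶠ n : ℕ in atTop, m n (fun s => F.indicator 1 (s / n)) ≤ Real.exp (-(n * (b - ε))) := by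
  choose! τ hτ using hb
  -- The averages live in [-D, D], so only a compact part of F matters and exponential tightness is
  -- automatic.
  have hcomp : IsCompact (F ∩ Set.Icc (-D) D) := isCompact_Icc.inter_left hF
  obtain ⟨T, hTF, hT⟩ := hcomp.elim_nhds_subcover (fun x => {y | b < τ x * y - Λ (τ x)})
    fun x hx => (isOpen_lt continuous_const (by fun_prop)).mem_nhds (hτ x hx.1)
  have hcast := tendsto_natCast_atTop_atTop (R := ℝ)
  have e₁ : ∀ᶠ n : ℕ in atTop, ∀ x ∈ T,
      Real.log (m n fun s => Real.exp (τ x * s)) / n < Λ (τ x) + ε / 2 :=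
    (Finset.eventually_all T).2 fun x _ =>
      (hΛ (τ x)).eventually (gt_mem_nhds (show Λ (τ x) < Λ (τ x) + ε / 2 by linarith))
  have e₂ := hcast.eventually_ge_atTop (Real.log (T.card + 1) / (ε / 2))
  filter_upwards [e₁, e₂, eventually_gt_atTop 0] with n h₁ h₂ hn0
  have hn : (0 : ℝ) < n := by exact_mod_cast hn0
  rw [div_le_iff₀ (by positivity)] at h₂
  have hm0 : ∀ x, 0 ≤ m n fun s => Real.exp (τ x * s) := fun x => by
    simpa using h.mono n 0 (fun s => Real.exp (τ x * s)) fun s _ => (Real.exp_pos _).le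
  have hm : ∀ x ∈ T, (m n fun s => Real.exp (τ x * s)) ≤ Real.exp (n * (Λ (τ x) + ε / 2)) := by
    intro x hx
    have h3 := h₁ x hx
    rw [div_lt_iff₀ hn] at h3
    rcases (hm0 x).eq_or_lt with h4 | h4
    · rw [← h4]; exact (Real.exp_pos _).le
    · rw [← Real.exp_log h4, Real.exp_le_exp]; linarith
  -- At a point s / n of F in [-D, D] some chosen slope τ x makes exp (τ x * s - n (b + Λ (τ x))) at
  -- least 1, so the sum of these exponentials dominates the indicator.
  have hbound : m n (fun s => F.indicator 1 (s / n)) ≤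
      ∑ x ∈ T, Real.exp (-(n * (b + Λ (τ x)))) * m n fun s => Real.exp (τ x * s) := by
    have : ∑ x ∈ T, Real.exp (-(n * (b + Λ (τ x)))) * m n (fun s => Real.exp (τ x * s)) =
        m n (∑ x ∈ T, Real.exp (-(n * (b + Λ (τ x)))) • fun s => Real.exp (τ x * s)) := by
      simp [map_sum]
    rw [this]
    refine h.mono _ _ _ fun s hs => ?_
    have hnn : ∀ x ∈ T, 0 ≤ (Real.exp (-(n * (b + Λ (τ x)))) • fun s => Real.exp (τ x * s)) s :=
      fun x _ => mul_nonneg (Real.exp_pos _).le (Real.exp_pos _).le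
    rw [Finset.sum_apply]
    by_cases hsF : s / n ∈ F
    · have hs' : s / n ∈ Set.Icc (-D) D := by
        rw [abs_le] at hs
        rw [Set.mem_Icc, le_div_iff₀ hn, div_le_iff₀ hn]
        constructor <;> linarith
      obtain ⟨x, hx, hxs⟩ := Set.mem_iUnion₂.1 (hT ⟨hsF, hs'⟩)
      refine le_trans ?_ (Finset.single_le_sum hnn hx)
      rw [Set.indicator_of_mem hsF]
      simp only [Pi.smul_apply, smul_eq_mul, ← Real.exp_add, Pi.one_apply]
      rw [Real.one_le_exp_iff]
      have h5 : n * b ≤ n * (τ x * (s / n) - Λ (τ x)) :=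
        mul_le_mul_of_nonneg_left (le_of_lt hxs) hn.le
      have h6 : n * (τ x * (s / n) - Λ (τ x)) = τ x * s - n * Λ (τ x) := by field_simp
      linarith
    · rw [Set.indicator_of_notMem hsF]
      exact Finset.sum_nonneg hnn
  refine hbound.trans ?_
  have hsum : ∑ x ∈ T, Real.exp (-(n * (b + Λ (τ x)))) * m n (fun s => Real.exp (τ x * s)) ≤
      ∑ x ∈ T, Real.exp (-(n * (b - ε / 2))) := by
    refine Finset.sum_le_sum fun x hx => ?_
    refine (mul_le_mul_of_nonneg_left (hm x hx) (Real.exp_pos _).le).trans ?_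
    rw [← Real.exp_add, Real.exp_le_exp]
    linarith
  rw [Finset.sum_const, nsmul_eq_mul] at hsum
  refine hsum.trans ?_
  have hcard : (T.card : ℝ) ≤ Real.exp (n * (ε / 2)) := by
    have : (T.card + 1 : ℝ) ≤ Real.exp (n * (ε / 2)) := by
      rw [← Real.exp_log (show (0 : ℝ) < T.card + 1 by positivity)]
      exact Real.exp_le_exp.2 h₂
    linarith
  refine (mul_le_mul_of_nonneg_right hcard (Real.exp_pos _).le).trans ?_
  rw [← Real.exp_add, Real.exp_le_exp]
  linarith

end IsMixingFamily
-- Ultrafilter limits and boundedness of states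
-- Along one ultrafilter all bounded sequences converge, so the limits depend linearly on the
-- observable without any passage to subsequences.
theorem exists_tendsto_ultrafilter {F : Type*} [NormedAddCommGroup F] [ProperSpace F]
    (U : Ultrafilter ℕ) {f : ℕ → F} {R : ℝ} (hf : ∀ n, ‖f n‖ ≤ R) :
    ∃ z, Tendsto f U (nhds z) := by
  obtain ⟨z, -, hz⟩ := (isCompact_closedBall (0 : F) R).ultrafilter_le_nhds' (U.map f)
    (Filter.mem_map.2 (univ_mem' fun n => by simpa using hf n))
  exact ⟨z, hz⟩

theorem norm_cesaro_le {F : Type*} [NormedAddCommGroup F] [NormedSpace ℝ F] {f : ℕ → F} {R : ℝ}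
    (hR : 0 ≤ R) (hf : ∀ n, ‖f n‖ ≤ R) (N : ℕ) :
    ‖(N : ℝ)⁻¹ • ∑ k ∈ Finset.range N, f k‖ ≤ R := by
  rw [norm_smul, Real.norm_of_nonneg (by positivity)]
  have h : ‖∑ k ∈ Finset.range N, f k‖ ≤ N * R := by
    simpa using norm_sum_le_of_le (Finset.range N) fun k _ => hf k
  rcases N.eq_zero_or_pos with rfl | hN
  · simpa using hR
  · have hN' : (0 : ℝ) < N := by exact_mod_cast hN
    calc (N : ℝ)⁻¹ * ‖∑ k ∈ Finset.range N, f k‖ ≤ (N : ℝ)⁻¹ * (N * R) := by gcongr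
      _ = R := by field_simp

theorem IsState.exists_norm_le {C : Type*} [CStarAlgebra C] {φ : C →ₗ[ℂ] ℂ} (h : IsState φ) :
    ∃ R : ℝ, 0 ≤ R ∧ ∀ x, ‖φ x‖ ≤ R * ‖x‖ := by
  let _ := CStarAlgebra.spectralOrder C
  have := CStarAlgebra.spectralOrderedRing C
  obtain ⟨R, hR⟩ := PositiveLinearMap.exists_norm_apply_le (PositiveLinearMap.mk₀ φ fun x hx => by
    obtain ⟨y, rfl⟩ := CStarAlgebra.nonneg_iff_eq_star_mul_self.1 hx
    exact h.nonneg y)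
  exact ⟨R, R.2, hR⟩

/-! ### Ergodicity implies clustering in the mean -/

section Cluster

variable {C : Type*} [CStarAlgebra C] {γ : C →⋆ₐ[ℂ] C} {ω : C →ₗ[ℂ] ℂ}

theorem iterate_map_star (γ : C →⋆ₐ[ℂ] C) (k : ℕ) (x : C) : γ^[k] (star x) = star (γ^[k] x) := by
  induction k generalizing x with
  | zero => rfl
  | succ k ih => rw [Function.iterate_succ_apply, Function.iterate_succ_apply, map_star, ih]

theorem norm_iterate_le (γ : C →⋆ₐ[ℂ] C) (k : ℕ) (x : C) : ‖γ^[k] x‖ ≤ ‖x‖ := by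
  induction k generalizing x with
  | zero => exact le_rfl
  | succ k ih =>
    rw [Function.iterate_succ_apply]
    exact (ih _).trans (NonUnitalStarAlgHom.norm_apply_le γ x)

theorem apply_iterate (hinv : ∀ x, ω (γ x) = ω x) (k : ℕ) (x : C) : ω (γ^[k] x) = ω x := by
  induction k with
  | zero => rfl
  | succ k ih => rw [Function.iterate_succ_apply', hinv, ih]

/-- A limit of averages `N⁻¹ ∑ ω (x* x γ^k(v))`, `v` an asymptotically central projection, is
non-negative. -/
theorem cesaro_limit_nonneg (hω : IsState ω) {v : C}
    (hsa : star v = v) (hidem : v * v = v)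
    (hcomm : ∀ x, Tendsto (fun k => x * γ^[k] v - γ^[k] v * x) atTop (nhds 0))
    {U : Filter ℕ} [NeBot U] (hU : U ≤ atTop) {x : C} {z : ℂ}
    (hz : Tendsto (fun N : ℕ => (N : ℝ)⁻¹ • ∑ k ∈ Finset.range N, ω (star x * x * γ^[k] v)) U
      (nhds z)) : 0 ≤ z := by
  obtain ⟨R, hR0, hR⟩ := hω.exists_norm_le
  -- Up to this vanishing commutator, x* x γ^k(v) equals (γ^k(v) x)* (γ^k(v) x), because v is a
  -- projection.
  have hnull : Tendsto (fun k => ω (star x * (x * γ^[k] v - γ^[k] v * x))) atTop (nhds 0) := by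
    have h1 : Tendsto (fun k => R * (‖star x‖ * ‖x * γ^[k] v - γ^[k] v * x‖)) atTop
        (nhds (R * (‖star x‖ * 0))) :=
      ((tendsto_zero_iff_norm_tendsto_zero.1 (hcomm x)).const_mul _).const_mul _
    rw [mul_zero, mul_zero] at h1
    exact squeeze_zero_norm (fun k => (hR _).trans
      (mul_le_mul_of_nonneg_left (norm_mul_le _ _) hR0)) h1
  have hpos : ∀ k, 0 ≤ ω (star x * (γ^[k] v * x)) := fun k => by
    have : star x * (γ^[k] v * x) = star (γ^[k] v * x) * (γ^[k] v * x) := by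
      rw [star_mul, ← iterate_map_star, hsa, mul_assoc, ← mul_assoc (γ^[k] v), ← iterate_map_mul,
        hidem]
    rw [this]
    exact hω.nonneg _
  have hlim := hz.sub (hnull.cesaro_smul.mono_left hU)
  rw [sub_zero] at hlim
  refine ge_of_tendsto' hlim fun N => ?_
  rw [← smul_sub, ← Finset.sum_sub_distrib]
  refine smul_nonneg (by positivity) (Finset.sum_nonneg fun k _ => ?_)
  rw [← map_sub]
  convert hpos k using 2
  noncomm_ring

/-- Ergodicity, i.e. extremality among the invariant states, implies clustering in the mean. -/
theorem tendsto_cesaro_of_extreme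
    (hext : ω ∈ Set.extremePoints ℝ {φ : C →ₗ[ℂ] ℂ | IsState φ ∧ ∀ x, φ (γ x) = φ x}) {v : C}
    (hsa : star v = v) (hidem : v * v = v) (hv : ω v ≠ 0)
    (hcomm : ∀ x, Tendsto (fun k => x * γ^[k] v - γ^[k] v * x) atTop (nhds 0))
    (U : Ultrafilter ℕ) (hU : (U : Filter ℕ) ≤ atTop) (x : C) :
    Tendsto (fun N : ℕ => (N : ℝ)⁻¹ • ∑ k ∈ Finset.range N, ω (x * γ^[k] v)) U
      (nhds (ω x * ω v)) := by
  rw [mem_extremePoints] at hext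
  obtain ⟨⟨hω, hinv⟩, hext⟩ := hext
  obtain ⟨R, hR0, hR⟩ := hω.exists_norm_le
  have hterm : ∀ x k, ‖ω (x * γ^[k] v)‖ ≤ R * (‖x‖ * ‖v‖) := fun x k =>
    (hR _).trans (mul_le_mul_of_nonneg_left ((norm_mul_le _ _).trans
      (mul_le_mul_of_nonneg_left (norm_iterate_le γ k v) (norm_nonneg x))) hR0)
  -- ψ is the unnormalized state obtained from ω by conditioning on v at infinity; the aim is ψ =
  -- ω(v) ω.
  choose ψ hψ using fun x => exists_tendsto_ultrafilter U
    (norm_cesaro_le (by positivity) (hterm x))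
  have hadd : ∀ x y, ψ (x + y) = ψ x + ψ y := fun x y => by
    refine tendsto_nhds_unique (hψ (x + y)) (((hψ x).add (hψ y)).congr fun N => ?_)
    rw [← smul_add, ← Finset.sum_add_distrib]
    simp only [add_mul, map_add]
  have hsmul : ∀ (r : ℂ) x, ψ (r • x) = r • ψ x := fun r x => by
    refine tendsto_nhds_unique (hψ (r • x)) (((hψ x).const_smul r).congr fun N => ?_)
    rw [smul_comm, Finset.smul_sum]
    simp only [smul_mul_assoc, map_smul]
  let Ψ : C →ₗ[ℂ] ℂ := { toFun := ψ, map_add' := hadd, map_smul' := hsmul }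
  have hpos1 : ∀ N : ℕ, N ∈ Set.Ioi 0 → (N : ℝ)⁻¹ * N = 1 := fun N hN => by
    have : (N : ℝ) ≠ 0 := by exact_mod_cast (Set.mem_Ioi.1 hN).ne'
    field_simp
  have hIoi : ∀ᶠ N in (U : Filter ℕ), N ∈ Set.Ioi 0 := hU (Ioi_mem_atTop 0)
  have hconst : ∀ w : ℂ, Tendsto (fun N : ℕ => (N : ℝ)⁻¹ • ∑ _k ∈ Finset.range N, w) U (nhds w) :=
    fun w => tendsto_const_nhds.congr' (by
      filter_upwards [hIoi] with N hN
      rw [Finset.sum_const, Finset.card_range, ← Nat.cast_smul_eq_nsmul ℝ, smul_smul, hpos1 N hN,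
        one_smul])
  have hψ1 : ψ 1 = ω v := by
    refine tendsto_nhds_unique (hψ 1) ((hconst (ω v)).congr fun N => ?_)
    simp only [one_mul, apply_iterate hinv]
  have hψinv : ∀ x, ψ (γ x) = ψ x := fun x => by
    refine tendsto_nhds_unique (hψ (γ x)) ?_
    -- Replacing x by γ(x) shifts the index of the average by one, leaving two boundary terms
    -- divided by N.
    have hb : Tendsto (fun N : ℕ => (N : ℝ)⁻¹ • (ω (γ x * v) - ω (γ x * γ^[N] v))) U (nhds 0) := by
      have h1 : Tendsto (fun N : ℕ => (N : ℝ)⁻¹ * (R * (‖γ x‖ * ‖v‖) + R * (‖γ x‖ * ‖v‖))) atTop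
          (nhds (0 * (R * (‖γ x‖ * ‖v‖) + R * (‖γ x‖ * ‖v‖)))) :=
        (tendsto_inv_atTop_zero.comp tendsto_natCast_atTop_atTop).mul_const _
      rw [zero_mul] at h1
      refine (squeeze_zero_norm (fun N => ?_) h1).mono_left hU
      rw [norm_smul, Real.norm_of_nonneg (by positivity)]
      exact mul_le_mul_of_nonneg_left ((norm_sub_le _ _).trans
        (add_le_add (hterm (γ x) 0) (hterm (γ x) N))) (by positivity)
    have h2 := (hψ x).add hb
    rw [add_zero] at h2
    refine h2.congr fun N => ?_
    rw [← smul_add]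
    congr 1
    have h3 := Finset.sum_range_succ' (fun k => ω (γ x * γ^[k] v)) N
    rw [Finset.sum_range_succ] at h3
    have h4 : ∀ k, ω (γ x * γ^[k + 1] v) = ω (x * γ^[k] v) := fun k => by
      rw [Function.iterate_succ_apply', ← map_mul, hinv]
    simp only [h4, Function.iterate_zero, id] at h3
    linear_combination -h3
  have hψpos : ∀ x, 0 ≤ ψ (star x * x) := fun x =>
    cesaro_limit_nonneg hω hsa hidem hcomm hU (hψ _)
  -- The positivity argument for the complementary projection 1 - v yields ψ ≤ ω.
  have hsub : ∀ x, 0 ≤ ω (star x * x) - ψ (star x * x) := fun x => by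
    refine cesaro_limit_nonneg (v := 1 - v) hω (by rw [star_sub, star_one, hsa])
      (by rw [sub_mul, one_mul, mul_sub, mul_one, hidem, sub_self, sub_zero]) (γ := γ) (fun y => ?_) hU (x := x) ?_
    · refine ((hcomm y).neg).congr' (Eventually.of_forall fun k => ?_) |>.trans (by simp)
      simp only [iterate_map_sub, iterate_map_one]
      noncomm_ring
    · refine ((hconst (ω (star x * x))).sub (hψ (star x * x))).congr fun N => ?_
      rw [← smul_sub, ← Finset.sum_sub_distrib]
      simp only [iterate_map_sub, iterate_map_one, mul_sub, mul_one, map_sub]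
  have hv0 : 0 ≤ ω v := by
    have := hω.nonneg v
    rwa [hsa, hidem] at this
  have hv1 : ω v ≤ 1 := by
    have := hsub 1
    rw [star_one, mul_one, hω.map_one, hψ1] at this
    exact sub_nonneg.1 this
  obtain ⟨p, hp⟩ : ∃ p : ℝ, ω v = p := ⟨(ω v).re, (Complex.eq_re_of_ofReal_le hv0)⟩
  rw [hp] at hv0 hv1 hv hψ1
  have hp0 : 0 < p := lt_of_le_of_ne (by exact_mod_cast hv0) (by exact_mod_cast hv.symm)
  have hp1 : p ≤ 1 := by exact_mod_cast hv1
  have hq : 0 < 1 - p / 2 := by linarith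
  have hpC : (p : ℂ) ≠ 0 := hv
  have hqC : ((1 - p / 2 : ℝ) : ℂ) ≠ 0 := by exact_mod_cast hq.ne'
  -- With p = ω(v), ω is the mixture of ψ / p and (ω - ψ / 2) / (1 - p / 2) with weights p / 2 and 1
  -- - p / 2. Halving p keeps the second weight positive even for p = 1.
  have key := (hext (p⁻¹ • Ψ) ⟨⟨fun x => ?_, ?_⟩, fun x => ?_⟩
    ((1 - p / 2)⁻¹ • (ω - (2⁻¹ : ℝ) • Ψ)) ⟨⟨fun x => ?_, ?_⟩, fun x => ?_⟩
    ⟨p / 2, 1 - p / 2, by linarith, hq, by ring, ?_⟩).1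
  · have h1 : p⁻¹ • ψ x = ω x := LinearMap.congr_fun key x
    have h2 : ψ x = ω x * ω v := by
      rw [hp, ← h1, Complex.real_smul]
      push_cast
      field_simp
    rw [← h2]
    exact hψ x
  · exact smul_nonneg (inv_nonneg.2 hp0.le) (hψpos x)
  · change p⁻¹ • ψ 1 = 1
    rw [hψ1, Complex.real_smul]
    push_cast
    field_simp
  · change p⁻¹ • ψ (γ x) = p⁻¹ • ψ x
    rw [hψinv]
  · refine smul_nonneg (inv_nonneg.2 hq.le) ?_
    change 0 ≤ ω (star x * x) - (2⁻¹ : ℝ) • ψ (star x * x)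
    have h1 : ω (star x * x) - (2⁻¹ : ℝ) • ψ (star x * x) =
        (ω (star x * x) - ψ (star x * x)) + (2⁻¹ : ℝ) • ψ (star x * x) := by
      rw [Complex.real_smul]; push_cast; ring
    rw [h1]
    exact add_nonneg (hsub x) (smul_nonneg (by norm_num) (hψpos x))
  · change (1 - p / 2)⁻¹ • (ω 1 - (2⁻¹ : ℝ) • ψ 1) = 1
    rw [hω.map_one, hψ1, Complex.real_smul, Complex.real_smul]
    push_cast at hqC ⊢
    rw [show (1 - 2⁻¹ * p : ℂ) = 1 - p / 2 by ring]
    exact inv_mul_cancel₀ hqC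
  · change (1 - p / 2)⁻¹ • (ω (γ x) - (2⁻¹ : ℝ) • ψ (γ x)) = (1 - p / 2)⁻¹ • (ω x - (2⁻¹ : ℝ) • ψ x)
    rw [hψinv, hinv]
  · rw [smul_smul, smul_smul, mul_inv_cancel₀ hq.ne', one_smul]
    have : p / 2 * p⁻¹ = 2⁻¹ := by field_simp
    rw [this]
    abel

end Cluster

/-! ### Words of one-site observables and asymptotic commutativity -/

section Chain

variable {ι : Type*} [Fintype ι] [DecidableEq ι]

theorem commute_siteHom {k l : ℤ} (hkl : k ≠ l) (M N : Matrix ι ι ℂ) :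
    Commute (siteHom k M) (siteHom l N) := by
  ext ψ σ
  change siteOp k M (siteOp l N ψ) σ = siteOp l N (siteOp k M ψ) σ
  simp only [siteOp_apply, Function.update_of_ne hkl, Function.update_of_ne hkl.symm,
    Finset.mul_sum]
  rw [Finset.sum_comm]
  refine Finset.sum_congr rfl fun i _ => Finset.sum_congr rfl fun j _ => ?_
  rw [Function.update_comm hkl]
  ring

variable (A : StarSubalgebra ℂ (Matrix ι ι ℂ))

theorem commute_site {k l : ℤ} (hkl : k ≠ l) (a b : A) : Commute (site A k a) (site A l b) :=
  Subtype.ext (commute_siteHom hkl (a : Matrix ι ι ℂ) b)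

/-- The product of the elements of a list, placed at consecutive sites starting with the site
`k`. -/
noncomputable def siteWord (k : ℤ) : List A → chain A
  | [] => 1
  | a :: l => site A k a * siteWord (k + 1) l

theorem siteWord_eq_prod (k : ℤ) (l : List A) :
    siteWord A k l = (List.ofFn fun i : Fin l.length => site A ((i : ℤ) + k) (l.get i)).prod := by
  induction l generalizing k with
  | nil => rfl
  | cons a l ih =>
    rw [siteWord, ih]
    simp [List.ofFn_succ, add_comm, add_left_comm]

theorem siteWord_append (k : ℤ) (l l' : List A) :
    siteWord A k (l ++ l') = siteWord A k l * siteWord A (k + l.length) l' := by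
  induction l generalizing k with
  | nil => simp [siteWord]
  | cons a l ih =>
    rw [List.cons_append, siteWord, siteWord, ih, mul_assoc]
    simp [add_comm, add_left_comm]

theorem shift_siteWord (k : ℤ) (l : List A) : shift A (siteWord A k l) = siteWord A (k + 1) l := by
  induction l generalizing k with
  | nil => exact map_one _
  | cons a l ih => rw [siteWord, map_mul, shift_site, ih, siteWord]

theorem iterate_shift_siteWord (n : ℕ) (k : ℤ) (l : List A) :
    (shift A)^[n] (siteWord A k l) = siteWord A (k + n) l := by
  induction n with
  | zero => simp
  | succ n ih => rw [Function.iterate_succ_apply', ih, shift_siteWord]; push_cast; ring_nf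

theorem iterate_shift_smul (n : ℕ) (r : ℂ) (x : chain A) :
    (shift A)^[n] (r • x) = r • (shift A)^[n] x := by
  induction n with
  | zero => rfl
  | succ n ih => rw [Function.iterate_succ_apply', ih, map_smul, Function.iterate_succ_apply']

theorem commute_site_siteWord {j k : ℤ} (hjk : j < k) (a : A) (l : List A) :
    Commute (site A j a) (siteWord A k l) := by
  induction l generalizing k with
  | nil => exact Commute.one_right _
  | cons b l ih => exact (commute_site A hjk.ne a b).mul_right (ih (by lia))

/-- An element that eventually commutes, under translation, with all one-site observables is
asymptotically central. -/
theorem tendsto_commutator {v : chain A} (hsa : star v = v)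
    (hv : ∀ (j : ℤ) (a : A), ∀ᶠ k in atTop, Commute (site A j a) ((shift A)^[k] v)) (x : chain A) :
    Tendsto (fun k => x * (shift A)^[k] v - (shift A)^[k] v * x) atTop (nhds 0) := by
  set w : ℕ → L2 (ℤ → ι) →L[ℂ] L2 (ℤ → ι) := fun k => ((shift A)^[k] v : chain A) with hw
  have hwsa : ∀ k, star (w k) = w k := fun k => by
    rw [hw]
    exact congrArg Subtype.val ((iterate_map_star (shift A) k v).symm.trans (by rw [hsa]))
  have hwn : ∀ k, ‖w k‖ ≤ ‖v‖ := fun k => norm_iterate_le (shift A) k v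
  -- The elements asymptotically commuting with the translates of v form a norm-closed *-subalgebra
  -- (closed under star as v is self-adjoint) containing all one-site observables.
  let S : StarSubalgebra ℂ (L2 (ℤ → ι) →L[ℂ] L2 (ℤ → ι)) :=
    { carrier := {y | Tendsto (fun k => y * w k - w k * y) atTop (nhds 0)}
      mul_mem' := by
        intro y z hy hz
        have h1 := (hz.const_mul y).add (hy.mul_const z)
        rw [mul_zero, zero_mul, add_zero] at h1
        refine h1.congr fun k => ?_
        noncomm_ring
      add_mem' := by
        intro y z hy hz
        have h1 := Tendsto.add hy hz
        rw [add_zero] at h1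
        refine h1.congr fun k => ?_
        noncomm_ring
      algebraMap_mem' := by
        intro r
        refine tendsto_const_nhds.congr fun k => ?_
        rw [Algebra.commutes, sub_self]
      star_mem' := by
        intro y hy
        have h1 := (Tendsto.star hy).neg
        rw [star_zero, neg_zero] at h1
        refine h1.congr fun k => ?_
        rw [star_sub, star_mul, star_mul, hwsa, neg_sub] }
  have hS : chain A ≤ S := by
    refine StarSubalgebra.topologicalClosure_minimal (iSup_le fun j => ?_) ?_
    · rintro _ ⟨a, ha, rfl⟩
      refine tendsto_const_nhds.congr' ?_
      filter_upwards [hv j ⟨a, ha⟩] with k hk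
      exact (sub_eq_zero.2 (congrArg Subtype.val hk.eq)).symm
    · refine isClosed_of_closure_subset fun y hy => ?_
      refine Metric.tendsto_atTop.2 fun ε hε => ?_
      obtain ⟨z, hz, hyz⟩ := Metric.mem_closure_iff.1 hy (ε / (4 * (‖v‖ + 1))) (by positivity)
      obtain ⟨N, hN⟩ := Metric.tendsto_atTop.1 (show Tendsto _ _ _ from hz) (ε / 2) (by positivity)
      refine ⟨N, fun k hk => ?_⟩
      have h1 := hN k hk
      rw [dist_zero_right] at h1 ⊢
      have h2 : y * w k - w k * y = (z * w k - w k * z) + ((y - z) * w k - w k * (y - z)) := by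
        noncomm_ring
      have h3 : ‖(y - z) * w k - w k * (y - z)‖ ≤ 2 * (‖y - z‖ * ‖v‖) := by
        refine (norm_sub_le _ _).trans ?_
        have h4 := (norm_mul_le (y - z) (w k)).trans
          (mul_le_mul_of_nonneg_left (hwn k) (norm_nonneg _))
        have h5 := (norm_mul_le (w k) (y - z)).trans
          (mul_le_mul_of_nonneg_right (hwn k) (norm_nonneg _))
        linarith
      rw [dist_eq_norm, lt_div_iff₀ (by positivity)] at hyz
      rw [h2]
      refine (norm_add_le _ _).trans_lt ?_
      nlinarith [norm_nonneg (y - z)]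
  rw [tendsto_subtype_rng]
  exact hS x.2

end Chain

/-! ### Local observables paired with their maps on B -/

section Local

variable {ι B : Type*} [Fintype ι] [DecidableEq ι] [Ring B] [Algebra ℂ B]
  {A : StarSubalgebra ℂ (Matrix ι ι ℂ)} {E : A ⊗[ℂ] B →ₗ[ℂ] B} {ρ : B →ₗ[ℂ] ℂ}
  {ω : chain A →ₗ[ℂ] ℂ}

/-- The pairs consisting of an observable at the sites `1, …, n` and the corresponding map on `B`;
they are spanned by the pairs `(a₁ ⊗ ⋯ ⊗ aₙ, E_{a₁} ∘ ⋯ ∘ E_{aₙ})`. -/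
noncomputable def localPairs (E : A ⊗[ℂ] B →ₗ[ℂ] B) (n : ℕ) : Submodule ℂ (chain A × Module.End ℂ B) :=
  Submodule.span ℂ {q | ∃ l : List A, l.length = n ∧
    q = (siteWord A 1 l, (l.map (partialMap E)).prod)}

/-- Carrying the observable and its map together avoids having to show that the map depends only on
the observable; by linearity words suffice. -/
theorem apply_of_mem_localPairs (hω : IsGeneratedBy A E ρ ω) {n : ℕ}
    {q : chain A × Module.End ℂ B} (hq : q ∈ localPairs E n) : ω q.1 = ρ (q.2 1) := by
  induction hq using Submodule.span_induction with
  | mem q hq =>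
    obtain ⟨l, -, rfl⟩ := hq
    rw [siteWord_eq_prod, hω.apply_prod l.length l.get]
    congr 3
    have h := congrArg (List.map (partialMap E)) (List.ofFn_get l)
    rw [List.map_ofFn] at h
    exact h
  | zero => simp
  | add p q _ _ hp hq => simp [hp, hq]
  | smul r q _ hq => simp [hq]

theorem mul_mem_localPairs {n m : ℕ} {p q : chain A × Module.End ℂ B}
    (hp : p ∈ localPairs E n) (hq : q ∈ localPairs E m) :
    (p.1 * (shift A)^[n] q.1, p.2 * q.2) ∈ localPairs E (n + m) := by
  induction hp, hq using Submodule.span_induction₂ with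
  | mem_mem p q hp hq =>
    obtain ⟨l, rfl, rfl⟩ := hp
    obtain ⟨l', rfl, rfl⟩ := hq
    refine Submodule.subset_span ⟨l ++ l', by simp, ?_⟩
    rw [siteWord_append, iterate_shift_siteWord, List.map_append, List.prod_append]
  | zero_left q _ =>
    convert (localPairs E (n + m)).zero_mem using 1
    simp
  | zero_right p _ =>
    convert (localPairs E (n + m)).zero_mem using 1
    simp [iterate_map_zero]
  | add_left p p' q _ _ _ h h' =>
    convert Submodule.add_mem _ h h' using 1
    simp [add_mul]
  | add_right p p' q _ _ _ h h' =>
    convert Submodule.add_mem _ h h' using 1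
    simp [mul_add, iterate_map_add]
  | smul_left r p q _ _ h =>
    convert Submodule.smul_mem _ r h using 1
    simp
  | smul_right r p q _ _ h =>
    convert Submodule.smul_mem _ r h using 1
    simp [iterate_shift_smul]

/-- Idle sites act on B through powers of `partialMap E 1`: this is how a gap between two blocks
enters. -/
theorem one_mem_localPairs (k : ℕ) :
    ((1 : chain A), partialMap E 1 ^ k) ∈ localPairs E k := by
  refine Submodule.subset_span ⟨List.replicate k 1, by simp, ?_⟩
  have h : ∀ (k : ℕ) (j : ℤ), siteWord A j (List.replicate k 1) = 1 := by
    intro k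
    induction k with
    | zero => intro j; rfl
    | succ k ih => intro j; rw [List.replicate_succ, siteWord, map_one, one_mul, ih]
  rw [h, List.map_replicate, List.prod_replicate]

theorem site_mem_localPairs (a : A) : (site A 1 a, partialMap E a) ∈ localPairs E 1 :=
  Submodule.subset_span ⟨[a], rfl, by simp [siteWord]⟩

theorem commute_site_of_mem_localPairs {n : ℕ} {q : chain A × Module.End ℂ B}
    (hq : q ∈ localPairs E n) {j : ℤ} {k : ℕ} (hjk : j < 1 + k) (a : A) :
    Commute (site A j a) ((shift A)^[k] q.1) := by
  induction hq using Submodule.span_induction with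
  | mem q hq =>
    obtain ⟨l, -, rfl⟩ := hq
    rw [iterate_shift_siteWord]
    exact commute_site_siteWord A hjk a l
  | zero => simp [iterate_map_zero]
  | add p q _ _ hp hq =>
    rw [Prod.fst_add, iterate_map_add]
    exact hp.add_right hq
  | smul r q _ hq =>
    rw [Prod.smul_fst, iterate_shift_smul]
    exact hq.smul_right r

theorem tendsto_commutator_of_mem_localPairs {n : ℕ} {q : chain A × Module.End ℂ B}
    (hq : q ∈ localPairs E n) (hsa : star q.1 = q.1) (x : chain A) :
    Tendsto (fun k => x * (shift A)^[k] q.1 - (shift A)^[k] q.1 * x) atTop (nhds 0) := by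
  refine tendsto_commutator A hsa (fun j a => ?_) x
  filter_upwards [eventually_ge_atTop j.toNat] with k hk
  exact commute_site_of_mem_localPairs hq (by lia) a

end Local

/-! ### Positive maps, faithful states and the spectral radius -/

/-- Positivity of a linear map between ordered spaces. -/
def IsPositiveMap {B D : Type*} [AddCommGroup B] [Module ℂ B] [PartialOrder B] [AddCommGroup D]
    [Module ℂ D] [PartialOrder D] (T : B →ₗ[ℂ] D) : Prop :=
  ∀ b, 0 ≤ b → 0 ≤ T b

section PositiveMaps

section Basic

variable {B : Type*} [AddCommGroup B] [Module ℂ B] [PartialOrder B]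

theorem IsPositiveMap.one : IsPositiveMap (1 : Module.End ℂ B) := fun _ hb => hb

theorem IsPositiveMap.mul {S T : Module.End ℂ B} (hS : IsPositiveMap S) (hT : IsPositiveMap T) :
    IsPositiveMap (S * T) := fun b hb => hS _ (hT b hb)

theorem IsPositiveMap.pow {T : Module.End ℂ B} (hT : IsPositiveMap T) (n : ℕ) :
    IsPositiveMap (T ^ n) := by
  induction n with
  | zero => exact IsPositiveMap.one
  | succ n ih => rw [pow_succ]; exact ih.mul hT

theorem IsPositiveMap.re_nonneg {φ : B →ₗ[ℂ] ℂ} (hφ : IsPositiveMap φ) {b : B} (hb : 0 ≤ b) :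
    0 ≤ (φ b).re := (Complex.nonneg_iff.1 (hφ b hb)).1

theorem IsPositiveMap.ofReal_re {φ : B →ₗ[ℂ] ℂ} (hφ : IsPositiveMap φ) {b : B} (hb : 0 ≤ b) :
    ((φ b).re : ℂ) = φ b := (Complex.eq_re_of_ofReal_le (hφ b hb)).symm

end Basic

variable {B : Type*} [CStarAlgebra B] [PartialOrder B] [StarOrderedRing B]

/-- On positive elements the bound holds without the 4; a general b is a combination of four
positive elements of norm at most ‖b‖. -/
theorem IsPositiveMap.norm_apply_le {D : Type*} [CStarAlgebra D] [PartialOrder D]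
    [StarOrderedRing D] {T : B →ₗ[ℂ] D} (hT : IsPositiveMap T) (b : B) :
    ‖T b‖ ≤ 4 * ‖T 1‖ * ‖b‖ := by
  obtain ⟨y, hy0, hyn, hy⟩ := CStarAlgebra.exists_sum_four_nonneg b
  conv_lhs => rw [hy]
  rw [map_sum]
  have h : ∀ i : Fin 4, ‖T (Complex.I ^ (i : ℕ) • y i)‖ ≤ ‖T 1‖ * ‖b‖ := fun i => by
    rw [map_smul, norm_smul, norm_pow, Complex.norm_I, one_pow, one_mul]
    exact (PositiveLinearMap.norm_apply_le_of_nonneg (PositiveLinearMap.mk₀ T hT) (y i)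
      (hy0 i)).trans (mul_le_mul_of_nonneg_left (hyn i) (norm_nonneg _))
  refine (norm_sum_le_of_le _ fun i _ => h i).trans ?_
  simp [mul_assoc]

theorem IsPositiveMap.sum {J : Type*} {s : Finset J} {T : J → Module.End ℂ B}
    (hT : ∀ j ∈ s, IsPositiveMap (T j)) : IsPositiveMap (∑ j ∈ s, T j) := fun b hb => by
  rw [LinearMap.sum_apply]
  exact Finset.sum_nonneg fun j hj => hT j hj b hb

theorem IsPositiveMap.smul {T : Module.End ℂ B} (hT : IsPositiveMap T) {r : ℝ} (hr : 0 ≤ r) :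
    IsPositiveMap ((r : ℂ) • T) := fun b hb => by
  rw [LinearMap.smul_apply, Complex.coe_smul]
  exact smul_nonneg hr (hT b hb)

theorem IsState.isPositiveMap {ρ : B →ₗ[ℂ] ℂ} (hρ : IsState ρ) : IsPositiveMap ρ := fun b hb => by
  obtain ⟨y, rfl⟩ := CStarAlgebra.nonneg_iff_eq_star_mul_self.1 hb
  exact hρ.nonneg y

/-- A faithful state is strictly positive on the compact set of positive elements of norm 1, hence
bounded away from zero there. -/
theorem exists_norm_le_of_faithful [FiniteDimensional ℂ B] {ρ : B →ₗ[ℂ] ℂ} (hρ : IsState ρ)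
    (hfaith : ∀ b, ρ (star b * b) = 0 → b = 0) :
    ∃ C : ℝ, 0 < C ∧ ∀ b : B, 0 ≤ b → ‖b‖ ≤ C * (ρ b).re := by
  have : ProperSpace B := FiniteDimensional.proper ℂ B
  have hcont : Continuous fun b => (ρ b).re :=
    Complex.continuous_re.comp (LinearMap.continuous_of_finiteDimensional ρ)
  have hcomp : IsCompact ({b : B | 0 ≤ b} ∩ Metric.sphere 0 1) :=
    (isCompact_sphere _ _).inter_left CStarAlgebra.isClosed_nonneg
  have hpos : ∀ b ∈ {b : B | 0 ≤ b} ∩ Metric.sphere 0 1, 0 < (ρ b).re := by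
    rintro b ⟨hb, hb1⟩
    refine lt_of_le_of_ne (hρ.isPositiveMap.re_nonneg hb) fun h0 => ?_
    have h1 : ρ b = 0 := by rw [← hρ.isPositiveMap.ofReal_re hb, ← h0, Complex.ofReal_zero]
    obtain ⟨y, rfl⟩ := CStarAlgebra.nonneg_iff_eq_star_mul_self.1 hb
    rw [hfaith y h1] at hb1
    simp at hb1
  obtain ⟨κ, hκ0, hκ⟩ : ∃ κ > 0, ∀ b ∈ {b : B | 0 ≤ b} ∩ Metric.sphere 0 1, κ ≤ (ρ b).re := by
    rcases ({b : B | 0 ≤ b} ∩ Metric.sphere 0 1).eq_empty_or_nonempty with he | hne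
    · exact ⟨1, one_pos, by simp [he]⟩
    · obtain ⟨b, hb, hmin⟩ := hcomp.exists_isMinOn hne hcont.continuousOn
      exact ⟨_, hpos b hb, fun y hy => hmin hy⟩
  refine ⟨κ⁻¹, inv_pos.2 hκ0, fun b hb => ?_⟩
  rw [inv_mul_eq_div, le_div_iff₀ hκ0]
  rcases eq_or_ne b 0 with rfl | hb0
  · simp
  · have hn : 0 < ‖b‖ := norm_pos_iff.2 hb0
    have h1 := hκ (((‖b‖⁻¹ : ℝ) : ℂ) • b) ⟨by
      rw [Set.mem_ofPred_eq, Complex.coe_smul]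
      exact smul_nonneg (inv_nonneg.2 hn.le) hb, by
      simp [norm_smul, hn.ne']⟩
    rw [map_smul, smul_eq_mul, Complex.re_ofReal_mul, inv_mul_eq_div, le_div_iff₀ hn] at h1
    linarith

/-- For a positive map `Φ` and a faithful state `ρ`, the numbers `ρ (Φⁿ 1)` grow like the powers
of the spectral radius. -/
theorem tendsto_log_div_spectralRadius [FiniteDimensional ℂ B] {ρ : B →ₗ[ℂ] ℂ} (hρ : IsState ρ)
    (hfaith : ∀ b, ρ (star b * b) = 0 → b = 0) {Φ : Module.End ℂ B} (hΦ : IsPositiveMap Φ)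
    {κ : ℝ} (hκ : 0 < κ) (hlow : ∀ n : ℕ, κ ^ n ≤ (ρ ((Φ ^ n) 1)).re) :
    Tendsto (fun n : ℕ => Real.log (ρ ((Φ ^ n) 1)).re / n) atTop
      (nhds (Real.log (spectralRadius ℂ Φ).toReal)) := by
  have : Nontrivial B := by
    refine ⟨1, 0, fun h => ?_⟩
    have := hρ.map_one
    rw [h, map_zero] at this
    exact zero_ne_one this
  have : CompleteSpace B := FiniteDimensional.complete ℂ B
  obtain ⟨C, hC0, hC⟩ := exists_norm_le_of_faithful hρ hfaith
  obtain ⟨R, hR0, hR⟩ := hρ.exists_norm_le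
  set Ψ : B →L[ℂ] B := Module.End.toContinuousLinearMap B Φ with hΨ
  have hpow : ∀ (n : ℕ) b, (Ψ ^ n) b = (Φ ^ n) b := fun n b => by
    rw [hΨ, ← map_pow]; rfl
  have hrad : spectralRadius ℂ Φ = spectralRadius ℂ Ψ := by
    rw [spectralRadius, spectralRadius, hΨ, AlgEquiv.spectrum_eq]
  have hpos : ∀ n : ℕ, 0 < (ρ ((Φ ^ n) 1)).re := fun n => (pow_pos hκ n).trans_le (hlow n)
  have hup : ∀ n : ℕ, (ρ ((Φ ^ n) 1)).re ≤ (R * ‖(1 : B)‖ + 1) * ‖Ψ ^ n‖ := fun n => by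
    have h1 := (Complex.re_le_norm _).trans (hR ((Φ ^ n) 1))
    rw [← hpow] at h1 ⊢
    have h2 := mul_le_mul_of_nonneg_left ((Ψ ^ n).le_opNorm 1) hR0
    nlinarith [norm_nonneg (Ψ ^ n)]
  -- Positivity controls ‖Φⁿ‖ by ‖Φⁿ 1‖, and faithfulness controls the latter by ρ (Φⁿ 1). The
  -- constants disappear after taking log and dividing by n.
  have hdown : ∀ n : ℕ, ‖Ψ ^ n‖ ≤ 4 * C * (ρ ((Φ ^ n) 1)).re := fun n => by
    refine ContinuousLinearMap.opNorm_le_bound _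
      (mul_nonneg (by positivity) (hpos n).le) fun b => ?_
    rw [hpow]
    refine ((hΦ.pow n).norm_apply_le b).trans (mul_le_mul_of_nonneg_right ?_ (norm_nonneg b))
    rw [mul_assoc]
    exact mul_le_mul_of_nonneg_left (hC _ (hΦ.pow n 1 zero_le_one)) (by norm_num)
  set C₁ : ℝ := R * ‖(1 : B)‖ + 1 with hC₁
  have hC₁0 : 0 < C₁ := by positivity
  have hΨpos : ∀ n : ℕ, 0 < ‖Ψ ^ n‖ := fun n =>
    pos_of_mul_pos_right ((hpos n).trans_le (hup n)) hC₁0.le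
  set r := (spectralRadius ℂ Φ).toReal with hr
  have hlim : Tendsto (fun n : ℕ => ‖Ψ ^ n‖ ^ (1 / n : ℝ)) atTop (nhds r) := by
    have h1 := spectrum.pow_norm_pow_one_div_tendsto_nhds_spectralRadius Ψ
    have h2 : spectralRadius ℂ Ψ ≠ ⊤ :=
      ((spectrum.spectralRadius_le_nnnorm Ψ).trans_lt ENNReal.coe_lt_top).ne
    have h3 := (ENNReal.tendsto_toReal h2).comp h1
    rw [hr, hrad]
    refine h3.congr fun n => ?_
    exact ENNReal.toReal_ofReal (by positivity)
  have hinv : Tendsto (fun n : ℕ => (1 / n : ℝ)) atTop (nhds 0) := tendsto_one_div_atTop_nhds_zero_nat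
  -- Continuity of the logarithm at r requires r ≠ 0; the bound `hlow` excludes a nilpotent Φ.
  have hr0 : 0 < r := by
    refine hκ.trans_le ?_
    have h1 : Tendsto (fun n : ℕ => C₁ ^ (1 / n : ℝ) * ‖Ψ ^ n‖ ^ (1 / n : ℝ)) atTop
        (nhds (C₁ ^ (0 : ℝ) * r)) :=
      ((Real.continuousAt_const_rpow hC₁0.ne').tendsto.comp hinv).mul hlim
    rw [Real.rpow_zero, one_mul] at h1
    refine ge_of_tendsto h1 ?_
    filter_upwards [eventually_ne_atTop 0] with n hn
    rw [← Real.mul_rpow hC₁0.le (norm_nonneg _)]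
    calc κ = (κ ^ n) ^ (1 / n : ℝ) := by rw [one_div, Real.pow_rpow_inv_natCast hκ.le hn]
      _ ≤ _ := Real.rpow_le_rpow (by positivity) ((hlow n).trans (hup n)) (by positivity)
  have hlog : Tendsto (fun n : ℕ => Real.log ‖Ψ ^ n‖ / n) atTop (nhds (Real.log r)) := by
    refine (hlim.log hr0.ne').congr fun n => ?_
    rw [Real.log_rpow (hΨpos n)]
    ring
  have l₁ : Tendsto (fun n : ℕ => Real.log ‖Ψ ^ n‖ / n + Real.log C₁ * (1 / n)) atTop
      (nhds (Real.log r)) := by simpa using hlog.add (hinv.const_mul (Real.log C₁))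
  have l₂ : Tendsto (fun n : ℕ => Real.log ‖Ψ ^ n‖ / n - Real.log (4 * C) * (1 / n)) atTop
      (nhds (Real.log r)) := by simpa using hlog.sub (hinv.const_mul (Real.log (4 * C)))
  refine tendsto_of_tendsto_of_tendsto_of_le_of_le l₂ l₁ (fun n => ?_) fun n => ?_
  · have h1 := Real.log_le_log (hΨpos n) (hdown n)
    rw [Real.log_mul (by positivity) (hpos n).ne'] at h1
    have h2 : (Real.log ‖Ψ ^ n‖ - Real.log (4 * C)) * (1 / n : ℝ) ≤
        Real.log (ρ ((Φ ^ n) 1)).re * (1 / n : ℝ) :=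
      mul_le_mul_of_nonneg_right (by linarith) (by positivity)
    calc _ = (Real.log ‖Ψ ^ n‖ - Real.log (4 * C)) * (1 / n : ℝ) := by ring
      _ ≤ _ := h2
      _ = _ := by ring
  · have h1 := Real.log_le_log (hpos n) (hup n)
    rw [Real.log_mul hC₁0.ne' (hΨpos n).ne'] at h1
    have h2 : Real.log (ρ ((Φ ^ n) 1)).re * (1 / n : ℝ) ≤
        (Real.log ‖Ψ ^ n‖ + Real.log C₁) * (1 / n : ℝ) :=
      mul_le_mul_of_nonneg_right (by linarith) (by positivity)
    calc _ = Real.log (ρ ((Φ ^ n) 1)).re * (1 / n : ℝ) := by ring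
      _ ≤ _ := h2
      _ = _ := by ring

end PositiveMaps

/-! ### Uniform lower bounds for separated blocks -/

section Mixing

theorem partialMap_one_pow_apply_one {A B : Type*} [Ring A] [StarRing A] [Algebra ℂ A]
    [StarModule ℂ A] [Ring B] [StarRing B] [Algebra ℂ B] [StarModule ℂ B]
    {E : A ⊗[ℂ] B →ₗ[ℂ] B} {ρ : B →ₗ[ℂ] ℂ} (hE : IsGeneratingTriple E ρ) (k : ℕ) :
    (partialMap E 1 ^ k) 1 = 1 := by
  induction k with
  | zero => rfl
  | succ k ih =>
    rw [pow_succ', Module.End.mul_apply, ih]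
    exact hE.unital

variable {ι B : Type*} [Fintype ι] [DecidableEq ι] [CStarAlgebra B] [PartialOrder B]
  [StarOrderedRing B] {A : StarSubalgebra ℂ (Matrix ι ι ℂ)} {E : A ⊗[ℂ] B →ₗ[ℂ] B}
  {ρ : B →ₗ[ℂ] ℂ} {ω : chain A →ₗ[ℂ] ℂ}

theorem isPositiveMap_partialMap (hE : IsCompletelyPositive E) (a : A) :
    IsPositiveMap (partialMap E (star a * a)) := fun b hb => by
  obtain ⟨y, rfl⟩ := CStarAlgebra.nonneg_iff_eq_star_mul_self.1 hb
  obtain ⟨Z, hZ⟩ := hE 1 (Matrix.of fun _ _ => a ⊗ₜ[ℂ] y)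
  have h := congrFun (congrFun hZ 0) 0
  simp only [Matrix.map_apply, Matrix.mul_apply, Matrix.conjTranspose_apply, Matrix.of_apply,
    Finset.univ_unique, Finset.sum_singleton] at h
  have h2 : partialMap E (star a * a) (star y * y) = E (star (a ⊗ₜ[ℂ] y) * a ⊗ₜ[ℂ] y) := by
    rw [TensorProduct.star_tmul, Algebra.TensorProduct.tmul_mul_tmul]; rfl
  rw [h2, h]
  exact star_mul_self_nonneg _

theorem isPositiveMap_partialMap_one (hE : IsCompletelyPositive E) :
    IsPositiveMap (partialMap E 1) := by
  simpa using isPositiveMap_partialMap hE (1 : A)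

/-- Observables at distant sites are, uniformly and up to a constant, bounded below by independent
ones. -/
theorem exists_mixing [FiniteDimensional ℂ B] (hE : IsGeneratingTriple E ρ)
    (hω : IsGeneratedBy A E ρ ω) (herg : IsErgodic A ω) :
    ∃ K : ℕ, 0 < K ∧ ∃ c : ℝ, 0 < c ∧ ∀ (n m : ℕ) (p q : chain A × Module.End ℂ B),
      p ∈ localPairs E n → q ∈ localPairs E m → IsPositiveMap p.2 → IsPositiveMap q.2 →
      star q.1 = q.1 → q.1 * q.1 = q.1 →
      c * (ρ (p.2 1)).re * (ρ (q.2 1)).re ≤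
        ∑ k ∈ Finset.range K, (ρ (p.2 ((partialMap E 1 ^ k) (q.2 1)))).re := by
  have : ProperSpace (B →L[ℂ] B) := FiniteDimensional.proper ℂ _
  have hρ := hE.isState.isPositiveMap
  have hTpos := isPositiveMap_partialMap_one hE.completelyPositive
  obtain ⟨C, hC0, hC⟩ := exists_norm_le_of_faithful hE.isState hE.faithful
  set T := partialMap E 1 with hT
  set S : B →L[ℂ] B := Module.End.toContinuousLinearMap B T with hS
  have hpow : ∀ (n : ℕ) b, (S ^ n) b = (T ^ n) b := fun n b => by
    rw [hS, ← map_pow]; rfl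
  have hSn : ∀ k, ‖S ^ k‖ ≤ 4 * ‖(1 : B)‖ := fun k => by
    refine ContinuousLinearMap.opNorm_le_bound _ (by positivity) fun b => ?_
    have := (hTpos.pow k).norm_apply_le b
    rwa [partialMap_one_pow_apply_one hE, ← hpow] at this
  let U : Ultrafilter ℕ := hyperfilter ℕ
  have hU : (U : Filter ℕ) ≤ atTop := Nat.hyperfilter_le_atTop
  obtain ⟨P, hP⟩ := exists_tendsto_ultrafilter U (norm_cesaro_le (by positivity) hSn)
  -- N is fixed before the observables p and q: convergence in operator norm, available in finite
  -- dimension, makes the estimate uniform.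
  obtain ⟨N, hN, hN0⟩ := ((Metric.tendsto_nhds.1 hP (1 / (8 * C)) (by positivity)).and
    (hU (Ioi_mem_atTop 0))).exists
  have hN0' : (0 : ℝ) < N := by exact_mod_cast hN0
  refine ⟨N, hN0, N / 2, by positivity, fun n m p q hp hq hp2 hq2 hsa hidem => ?_⟩
  set φ : B →ₗ[ℂ] ℂ := ρ ∘ₗ p.2 with hφ
  have hφpos : IsPositiveMap φ := fun b hb => hρ _ (hp2 b hb)
  set y := q.2 1 with hy
  have hy0 : 0 ≤ y := hq2 1 zero_le_one
  have hφ1 : 0 ≤ (φ 1).re := hφpos.re_nonneg zero_le_one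
  have hρy : 0 ≤ (ρ y).re := hρ.re_nonneg hy0
  change N / 2 * (φ 1).re * (ρ y).re ≤ ∑ k ∈ Finset.range N, (φ ((T ^ k) y)).re
  -- Clustering was derived only for events of non-zero probability; for the others the claim is
  -- trivial.
  rcases eq_or_ne (ω q.1) 0 with hz | hz
  · rw [apply_of_mem_localPairs hω hq] at hz
    have h0 : (ρ y).re = 0 := by rw [hy, hz, Complex.zero_re]
    rw [h0, mul_zero]
    exact Finset.sum_nonneg fun k _ => hφpos.re_nonneg (hTpos.pow k y hy0)
  have happly : ∀ M : ℕ, φ (((M : ℝ)⁻¹ • ∑ k ∈ Finset.range M, S ^ k) y) =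
      (M : ℝ)⁻¹ • ∑ k ∈ Finset.range M, φ ((T ^ k) y) := fun M => by
    rw [smul_apply, sum_apply, ← Complex.coe_smul,
      map_smul, map_sum, Complex.coe_smul]
    simp only [hpow]
  have hωterm : ∀ k, ω (p.1 * (shift A)^[k] ((shift A)^[n] q.1)) = φ ((T ^ k) y) := fun k => by
    have h1 := mul_mem_localPairs (mul_mem_localPairs hp (one_mem_localPairs k)) hq
    have h2 := apply_of_mem_localPairs hω h1
    simp only [iterate_map_one, mul_one] at h2
    rw [← Function.iterate_add_apply, add_comm k n, h2]
    rfl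
  have hinv := hω.mem_invariantStates.2
  have hclust := tendsto_cesaro_of_extreme (γ := shift A) herg (v := (shift A)^[n] q.1)
    (by rw [← iterate_map_star, hsa]) (by rw [← iterate_map_mul, hidem])
    (by rwa [apply_iterate hinv]) (fun x => by
      have h1 := (tendsto_commutator_of_mem_localPairs hq hsa x).comp (tendsto_add_atTop_nat n)
      refine h1.congr fun k => ?_
      simp only [Function.comp_apply, Function.iterate_add_apply]) U hU p.1
  rw [apply_iterate hinv, apply_of_mem_localPairs hω hp, apply_of_mem_localPairs hω hq] at hclust
  -- The powers T^k are the gaps of k idle sites between p and q, so clustering evaluates the limit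
  -- P on y.
  have hlim : φ (P y) = φ 1 * ρ y := by
    have hc : Continuous fun L : B →L[ℂ] B => φ (L y) :=
      (LinearMap.continuous_of_finiteDimensional φ).comp (ContinuousLinearMap.apply ℂ B y).continuous
    refine tendsto_nhds_unique ((hc.tendsto P).comp hP) (hclust.congr fun M => ?_)
    rw [Function.comp_apply, happly]
    simp only [hωterm]
  set L := (N : ℝ)⁻¹ • ∑ k ∈ Finset.range N, S ^ k with hL
  rw [dist_eq_norm] at hN
  -- The constants combine to 4 * (1 / (8 C)) * C = 1 / 2, so half of the product survives.
  have herr : ‖φ (L y) - φ (P y)‖ ≤ (φ 1).re * (ρ y).re / 2 := by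
    rw [← map_sub, ← sub_apply]
    refine (hφpos.norm_apply_le _).trans ?_
    have h1 : ‖φ 1‖ = (φ 1).re := by
      rw [← hφpos.ofReal_re zero_le_one, Complex.norm_of_nonneg hφ1, Complex.ofReal_re]
    have h2 : ‖(L - P) y‖ ≤ 1 / (8 * C) * (C * (ρ y).re) :=
      ((L - P).le_opNorm y).trans (mul_le_mul hN.le (hC y hy0) (norm_nonneg _) (by positivity))
    have h3 : 1 / (8 * C) * (C * (ρ y).re) = (ρ y).re / 8 := by field_simp
    rw [h1]
    rw [h3] at h2
    calc 4 * (φ 1).re * ‖(L - P) y‖ ≤ 4 * (φ 1).re * ((ρ y).re / 8) :=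
          mul_le_mul_of_nonneg_left h2 (by positivity)
      _ = _ := by ring
  have hre := (abs_le.1 ((Complex.abs_re_le_norm _).trans herr)).1
  rw [hlim, Complex.sub_re, ← hφpos.ofReal_re zero_le_one, ← hρ.ofReal_re hy0,
    ← Complex.ofReal_mul, Complex.ofReal_re, Complex.ofReal_re, Complex.ofReal_re, happly,
    Complex.smul_re, Complex.re_sum, smul_eq_mul] at hre
  have h4 : (φ 1).re * (ρ y).re / 2 ≤ (N : ℝ)⁻¹ * ∑ k ∈ Finset.range N, (φ ((T ^ k) y)).re := by
    linarith
  rw [inv_mul_eq_div, le_div_iff₀ hN0'] at h4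
  linarith

end Mixing

/-! ### Spectral decomposition inside the one-site algebra -/

section SpectralDecomposition

/-- `a = ∑ lam j • p j` with mutually orthogonal projections `p j` of sum `1`. -/
structure IsSpectralDecomposition {A J : Type*} [Fintype J] [DecidableEq J] [Ring A] [Star A]
    [Algebra ℂ A] (a : A) (lam : J → ℝ) (p : J → A) : Prop where
  star_eq : ∀ j, star (p j) = p j
  mul_eq : ∀ i j, p i * p j = if i = j then p i else 0
  sum_eq : ∑ j, p j = 1
  eq_sum : a = ∑ j, (lam j : ℂ) • p j

/-- The spectrum is finite, so by Lagrange interpolation the spectral projections are polynomials in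
a and remain in A. -/
theorem exists_isSpectralDecomposition {ι : Type*} [Fintype ι] [DecidableEq ι]
    {A : StarSubalgebra ℂ (Matrix ι ι ℂ)} {a : A} (ha : IsSelfAdjoint a) :
    ∃ (s : Finset ℝ) (p : s → A), IsSpectralDecomposition a (fun j : s => (j : ℝ)) p := by
  have hM : IsSelfAdjoint (a : Matrix ι ι ℂ) := congrArg Subtype.val ha
  have hfin : (spectrum ℝ (a : Matrix ι ι ℂ)).Finite := Matrix.finite_real_spectrum
  have hcont : ∀ f : ℝ → ℝ, ContinuousOn f (spectrum ℝ (a : Matrix ι ι ℂ)) := hfin.continuousOn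
  set s := hfin.toFinset with hs
  have hmem : ∀ f : ℝ → ℝ, cfc f (a : Matrix ι ι ℂ) ∈ A := fun f => by
    have h1 : cfc f (a : Matrix ι ι ℂ) =
        Polynomial.aeval (a : Matrix ι ι ℂ) (Lagrange.interpolate s id f) := by
      rw [← cfc_polynomial _ _ hM]
      refine cfc_congr fun x hx => ?_
      exact (Lagrange.eval_interpolate_at_node (v := id) f Function.injective_id.injOn
        (hfin.mem_toFinset.2 hx)).symm
    rw [h1, Polynomial.aeval_eq_sum_range]
    refine sum_mem fun i _ => ?_
    rw [← Complex.coe_smul]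
    exact A.smul_mem (pow_mem a.2 _) _
  refine ⟨s, fun j => ⟨cfc (({(j : ℝ)} : Set ℝ).indicator 1) (a : Matrix ι ι ℂ), hmem _⟩,
    fun j => Subtype.ext (cfc_predicate (p := IsSelfAdjoint) _ _), fun i j => Subtype.ext ?_,
    Subtype.ext ?_, Subtype.ext ?_⟩
  · change cfc _ _ * cfc _ _ = _
    rw [← cfc_mul _ _ _ (hcont _) (hcont _)]
    split_ifs with hij
    · subst hij
      refine cfc_congr fun x _ => ?_
      by_cases hx : x = (i : ℝ) <;> simp [hx]
    · refine (cfc_congr fun x _ => ?_).trans (cfc_const_zero ℝ (a : Matrix ι ι ℂ))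
      by_cases hx : x = (i : ℝ)
      · have : x ≠ (j : ℝ) := fun h => hij (Subtype.ext (hx.symm.trans h))
        simp [this]
      · simp [hx]
  · rw [AddSubmonoidClass.coe_finsetSum]
    change ∑ j : s, cfc _ _ = 1
    rw [← cfc_sum_univ _ _ fun _ => hcont _]
    refine (cfc_congr fun x hx => ?_).trans (cfc_const_one ℝ (a : Matrix ι ι ℂ) hM)
    rw [Finset.sum_apply, Finset.sum_eq_single (⟨x, hfin.mem_toFinset.2 hx⟩ : s)]
    · simp
    · intro j _ hj
      have : x ≠ (j : ℝ) := fun h => hj (Subtype.ext h.symm)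
      simp [this]
    · simp
  · rw [AddSubmonoidClass.coe_finsetSum]
    change (a : Matrix ι ι ℂ) = ∑ j : s, ((j : ℝ) : ℂ) • cfc _ _
    simp only [Complex.coe_smul]
    have h1 : ∀ j : s, (j : ℝ) • cfc (({(j : ℝ)} : Set ℝ).indicator 1) (a : Matrix ι ι ℂ) =
        cfc (fun x => (j : ℝ) • ({(j : ℝ)} : Set ℝ).indicator 1 x) (a : Matrix ι ι ℂ) :=
      fun j => (cfc_smul _ _ _ (hcont _)).symm
    rw [Finset.sum_congr rfl fun j _ => h1 j, ← cfc_sum_univ _ _ fun _ => hcont _]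
    nth_rewrite 1 [← cfc_id ℝ (a : Matrix ι ι ℂ) hM]
    refine cfc_congr fun x hx => ?_
    rw [Finset.sum_apply, Finset.sum_eq_single (⟨x, hfin.mem_toFinset.2 hx⟩ : s)]
    · simp
    · intro j _ hj
      have : x ≠ (j : ℝ) := fun h => hj (Subtype.ext h.symm)
      simp [this]
    · simp

theorem IsSpectralDecomposition.exp_eq {A J : Type*} [Fintype J] [DecidableEq J] [Ring A] [Star A]
    [Algebra ℂ A] [TopologicalSpace A] [IsTopologicalRing A] [T2Space A] [ContinuousSMul ℂ A]
    {a : A} {lam : J → ℝ} {p : J → A}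
    (h : IsSpectralDecomposition a lam p) (t : ℝ) :
    NormedSpace.exp ((t : ℂ) • a) = ∑ j, ((Real.exp (t * lam j) : ℝ) : ℂ) • p j := by
  have hpow : ∀ n : ℕ, ((t : ℂ) • a) ^ n = ∑ j, ((t * lam j : ℝ) : ℂ) ^ n • p j := fun n => by
    induction n with
    | zero => simp [h.sum_eq]
    | succ n ih =>
      rw [pow_succ, ih, h.eq_sum, Finset.smul_sum, Finset.sum_mul]
      refine Finset.sum_congr rfl fun j _ => ?_
      rw [Finset.mul_sum, Finset.sum_eq_single j]
      · rw [smul_smul, smul_mul_smul_comm, h.mul_eq, if_pos rfl, pow_succ]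
        push_cast
        rfl
      · intro i _ hij
        rw [smul_smul, smul_mul_smul_comm, h.mul_eq, if_neg hij.symm, smul_zero]
      · simp
  rw [NormedSpace.exp_eq_tsum ℂ]
  refine HasSum.tsum_eq ?_
  have h1 : ∀ j, HasSum (fun n : ℕ => ((n.factorial : ℂ)⁻¹ • ((t * lam j : ℝ) : ℂ) ^ n) • p j)
      (((Real.exp (t * lam j) : ℝ) : ℂ) • p j) := fun j => by
    rw [Complex.ofReal_exp, Complex.exp_eq_exp_ℂ]
    exact (NormedSpace.exp_series_hasSum_exp' (𝕂 := ℂ) ((t * lam j : ℝ) : ℂ)).smul_const (p j)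
  refine (hasSum_sum fun j _ => h1 j).congr_fun fun n => ?_
  rw [hpow, Finset.smul_sum]
  simp only [smul_assoc]

end SpectralDecomposition

/-! ### Functions of the sum as maps on B -/

section SumMap

variable {A B J : Type*} [Fintype J] [Ring A] [Algebra ℂ A] [Ring B] [Algebra ℂ B]
  (E : A ⊗[ℂ] B →ₗ[ℂ] B) (lam : J → ℝ) (p : J → A)

theorem partialMap_sum (T : J → A) : partialMap E (∑ j, T j) = ∑ j, partialMap E (T j) := by
  simp [partialMap, LinearMap.ext_iff]

theorem partialMap_smul (r : ℂ) (a : A) : partialMap E (r • a) = r • partialMap E a := by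
  ext b
  change E ((r • a) ⊗ₜ[ℂ] b) = r • E (a ⊗ₜ[ℂ] b)
  rw [← TensorProduct.smul_tmul', map_smul]

/-- The map `∑ f (lam j₁ + ⋯ + lam jₙ) • E_{p j₁} ∘ ⋯ ∘ E_{p jₙ}`, the sum extending over all
`j₁, …, jₙ`. -/
noncomputable def sumMap : ℕ → (ℝ → ℝ) → Module.End ℂ B
  | 0, f => (f 0 : ℂ) • 1
  | n + 1, f => ∑ j, partialMap E (p j) * sumMap n fun s => f (lam j + s)

theorem sumMap_add (n : ℕ) (f g : ℝ → ℝ) :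
    sumMap E lam p n (f + g) = sumMap E lam p n f + sumMap E lam p n g := by
  induction n generalizing f g with
  | zero => simp only [sumMap, Pi.add_apply, Complex.ofReal_add, add_smul]
  | succ n ih =>
    simp only [sumMap]
    rw [← Finset.sum_add_distrib]
    refine Finset.sum_congr rfl fun j _ => ?_
    rw [← mul_add, ← ih]
    rfl

theorem sumMap_smul (n : ℕ) (r : ℝ) (f : ℝ → ℝ) :
    sumMap E lam p n (r • f) = (r : ℂ) • sumMap E lam p n f := by
  induction n generalizing f with
  | zero => simp [sumMap, smul_smul]
  | succ n ih =>
    simp only [sumMap]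
    rw [Finset.smul_sum]
    refine Finset.sum_congr rfl fun j _ => ?_
    rw [← mul_smul_comm, ← ih]
    rfl

theorem sumMap_sub (n : ℕ) (f g : ℝ → ℝ) :
    sumMap E lam p n (f - g) = sumMap E lam p n f - sumMap E lam p n g := by
  rw [eq_sub_iff_add_eq, ← sumMap_add, sub_add_cancel]

/-- The exponential turns the sum over sites into a product, so the recursion collapses to a power
of one map. -/
theorem sumMap_exp (n : ℕ) (t : ℝ) : sumMap E lam p n (fun s => Real.exp (t * s)) =
    (∑ j, ((Real.exp (t * lam j) : ℝ) : ℂ) • partialMap E (p j)) ^ n := by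
  induction n with
  | zero => simp [sumMap]
  | succ n ih =>
    rw [pow_succ', ← ih, Finset.sum_mul]
    simp only [sumMap]
    refine Finset.sum_congr rfl fun j _ => ?_
    rw [smul_mul_assoc, ← mul_smul_comm, ← sumMap_smul]
    congr 2
    ext s
    simp [mul_add, Real.exp_add]

theorem sumMap_one (hp : ∑ j, p j = 1) (n : ℕ) : sumMap E lam p n 1 = partialMap E 1 ^ n := by
  have h := sumMap_exp E lam p n 0
  simp only [zero_mul, Real.exp_zero, Complex.ofReal_one, one_smul] at h
  rw [← partialMap_sum, hp] at h
  exact h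

end SumMap

/-! ### Comparison of sums over adjacent blocks -/

section Positivity

variable {ι B J : Type*} [Fintype ι] [DecidableEq ι] [Fintype J] [CStarAlgebra B] [PartialOrder B]
  [StarOrderedRing B] {A : StarSubalgebra ℂ (Matrix ι ι ℂ)} {E : A ⊗[ℂ] B →ₗ[ℂ] B}
  {lam : J → ℝ} {p : J → A} {D : ℝ}

theorem isPositiveMap_sumMap (hp : ∀ j, IsPositiveMap (partialMap E (p j)))
    (hD : ∀ j, |lam j| ≤ D) (n : ℕ) {f : ℝ → ℝ} (hf : ∀ s, |s| ≤ n * D → 0 ≤ f s) :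
    IsPositiveMap (sumMap E lam p n f) := by
  induction n generalizing f with
  | zero => exact IsPositiveMap.one.smul (hf 0 (by simp))
  | succ n ih =>
    refine IsPositiveMap.sum fun j _ => (hp j).mul (ih fun s hs => hf _ ?_)
    push_cast
    linarith [abs_add_le (lam j) s, hD j]

theorem isPositiveMap_sumMap_sub (hp : ∀ j, IsPositiveMap (partialMap E (p j)))
    (hD : ∀ j, |lam j| ≤ D) (n : ℕ) {f g : ℝ → ℝ} (hfg : ∀ s, |s| ≤ n * D → f s ≤ g s) :
    IsPositiveMap (sumMap E lam p n g - sumMap E lam p n f) := by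
  rw [← sumMap_sub]
  exact isPositiveMap_sumMap hp hD n fun s hs => sub_nonneg.2 (hfg s hs)

/-- A pointwise inequality between functions of the partial sums becomes an inequality of positive
maps. With windows it glues blocks; with g = 1 it pads a block by idle sites. -/
theorem isPositiveMap_sumMap_sub_mul (hp : ∀ j, IsPositiveMap (partialMap E (p j)))
    (hD : ∀ j, |lam j| ≤ D) (n m : ℕ) {f g h : ℝ → ℝ}
    (hfg : ∀ s s', |s| ≤ n * D → |s'| ≤ m * D → f s * g s' ≤ h (s + s')) :
    IsPositiveMap (sumMap E lam p (n + m) h - sumMap E lam p n f * sumMap E lam p m g) := by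
  induction n generalizing f h with
  | zero =>
    rw [zero_add]
    simp only [sumMap]
    rw [smul_mul_assoc, one_mul, ← sumMap_smul]
    refine isPositiveMap_sumMap_sub hp hD m fun s hs => ?_
    simpa using hfg 0 s (by simp) hs
  | succ n ih =>
    rw [Nat.add_right_comm]
    simp only [sumMap]
    rw [Finset.sum_mul, ← Finset.sum_sub_distrib]
    refine IsPositiveMap.sum fun j _ => ?_
    rw [mul_assoc, ← mul_sub]
    refine (hp j).mul (ih fun s s' hs hs' => ?_)
    rw [← add_assoc]
    refine hfg _ _ ?_ hs'
    push_cast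
    linarith [abs_add_le (lam j) s, hD j]

theorem window_mul_window_le (α β α' β' s s' : ℝ) :
    window α β s * window α' β' s' ≤ window (α + α') (β + β') (s + s') := by
  rcases le_or_gt |s - α| β with h | h
  · rcases le_or_gt |s' - α'| β' with h' | h'
    · rw [window_of_abs_le h, window_of_abs_le h', window_of_abs_le, mul_one]
      have : s + s' - (α + α') = (s - α) + (s' - α') := by ring
      rw [this]
      exact (abs_add_le _ _).trans (add_le_add h h')
    · rw [window_of_lt_abs h', mul_zero]
      exact window_nonneg _ _ _
  · rw [window_of_lt_abs h, zero_mul]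
    exact window_nonneg _ _ _

theorem window_mul_one_le {α β D s s' : ℝ} {k : ℕ} (hs' : |s'| ≤ k * D) :
    window α β s * (1 : ℝ → ℝ) s' ≤ window α (β + k * D) (s + s') := by
  have h := window_mul_window_le α β 0 (k * D) s s'
  rwa [window_of_abs_le (show |s' - 0| ≤ k * D by rwa [sub_zero]), add_zero] at h

end Positivity

/-! ### Functional calculus for the sum -/

/-- Since X only sees values on the finite set F, the spectrum of X h lies in h(F); there f agrees
with an interpolation polynomial, and polynomials commute with X. -/
theorem cfc_algHom {C : Type*} [CStarAlgebra C] (X : (ℝ → ℝ) →ₐ[ℝ] C) (F : Finset ℝ)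
    (hF : ∀ f g : ℝ → ℝ, (∀ s ∈ F, f s = g s) → X f = X g) {h : ℝ → ℝ}
    (hsa : IsSelfAdjoint (X h)) (f : ℝ → ℝ) : cfc f (X h) = X (f ∘ h) := by
  have hspec : spectrum ℝ (X h) ⊆ F.image h := fun r hr => by
    by_contra hcon
    refine hr ?_
    change IsUnit (algebraMap ℝ C r - X h)
    have hne : ∀ s ∈ F, r - h s ≠ 0 := fun s hs h0 =>
      hcon (Finset.mem_coe.2 (Finset.mem_image.2 ⟨s, hs, (sub_eq_zero.1 h0).symm⟩))
    have e : algebraMap ℝ C r - X h = X (fun s => r - h s) := by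
      rw [← X.commutes, ← map_sub]; rfl
    rw [e]
    refine ⟨⟨X (fun s => r - h s), X (fun s => (r - h s)⁻¹), ?_, ?_⟩, rfl⟩ <;>
      rw [← map_mul, ← map_one X] <;> refine hF _ _ fun s hs => ?_
    · exact mul_inv_cancel₀ (hne s hs)
    · exact inv_mul_cancel₀ (hne s hs)
  set q := Lagrange.interpolate (F.image h) id f with hq
  have heval : ∀ r ∈ F.image h, q.eval r = f r := fun r hr =>
    Lagrange.eval_interpolate_at_node (v := id) f Function.injective_id.injOn hr
  rw [cfc_congr (g := fun r => q.eval r) fun r hr => (heval r (hspec hr)).symm,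
    cfc_polynomial q (X h) hsa, Polynomial.aeval_algHom_apply]
  refine hF _ _ fun s hs => ?_
  have h1 := Polynomial.aeval_algHom_apply (Pi.evalAlgHom ℝ (fun _ : ℝ => ℝ) s) h q
  rw [Pi.evalAlgHom_apply, Pi.evalAlgHom_apply] at h1
  rw [← h1, Polynomial.coe_aeval_eq_eval]
  exact heval _ (Finset.mem_image_of_mem h hs)

section SumObs

variable {ι J : Type*} [Fintype ι] [DecidableEq ι] [Fintype J]
  {A : StarSubalgebra ℂ (Matrix ι ι ℂ)} {a : A} {lam : J → ℝ} {p : J → A}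

/-- The function `f` of the sum of the copies of `∑ lam j • p j` at the sites `1, …, n`. -/
noncomputable def sumObs (lam : J → ℝ) (p : J → A) : ℕ → (ℝ → ℝ) → chain A
  | 0, f => (f 0 : ℂ) • 1
  | n + 1, f => ∑ j, site A 1 (p j) * shift A (sumObs lam p n fun s => f (lam j + s))

theorem sumObs_mem_localPairs {B : Type*} [Ring B] [Algebra ℂ B] (E : A ⊗[ℂ] B →ₗ[ℂ] B) (n : ℕ)
    (f : ℝ → ℝ) : (sumObs lam p n f, sumMap E lam p n f) ∈ localPairs E n := by
  induction n generalizing f with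
  | zero =>
    have h := Submodule.smul_mem _ (f 0 : ℂ) (one_mem_localPairs (A := A) (E := E) 0)
    rwa [pow_zero] at h
  | succ n ih =>
    have h := Submodule.sum_mem (localPairs E (1 + n)) (t := Finset.univ) fun j _ =>
      mul_mem_localPairs (site_mem_localPairs (E := E) (p j)) (ih fun s => f (lam j + s))
    rw [add_comm 1 n] at h
    convert h using 1
    simp only [sumObs, sumMap, Function.iterate_one]
    ext1
    · rw [Prod.fst_sum]
    · rw [Prod.snd_sum]

theorem sumObs_add (n : ℕ) (f g : ℝ → ℝ) :
    sumObs lam p n (f + g) = sumObs lam p n f + sumObs lam p n g := by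
  induction n generalizing f g with
  | zero => simp only [sumObs, Pi.add_apply, Complex.ofReal_add, add_smul]
  | succ n ih =>
    simp only [sumObs]
    rw [← Finset.sum_add_distrib]
    refine Finset.sum_congr rfl fun j _ => ?_
    rw [← mul_add, ← map_add, ← ih]
    rfl

theorem sumObs_smul (n : ℕ) (r : ℝ) (f : ℝ → ℝ) :
    sumObs lam p n (r • f) = (r : ℂ) • sumObs lam p n f := by
  induction n generalizing f with
  | zero => simp only [sumObs, Pi.smul_apply, smul_eq_mul, Complex.ofReal_mul, smul_smul]
  | succ n ih =>
    simp only [sumObs]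
    rw [Finset.smul_sum]
    refine Finset.sum_congr rfl fun j _ => ?_
    rw [← mul_smul_comm, ← map_smul, ← ih]
    rfl

theorem commute_site_shift_sumObs (n : ℕ) (b : A) (f : ℝ → ℝ) :
    Commute (site A 1 b) (shift A (sumObs lam p n f)) :=
  -- Only the observable component matters, so the zero map with B = ℂ serves as a dummy.
  commute_site_of_mem_localPairs (sumObs_mem_localPairs (0 : A ⊗[ℂ] ℂ →ₗ[ℂ] ℂ) n f)
    (k := 1) (by norm_num) b

theorem exists_finset_sumObs (lam : J → ℝ) (p : J → A) (n : ℕ) : ∃ F : Finset ℝ,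
    ∀ f g : ℝ → ℝ, (∀ s ∈ F, f s = g s) → sumObs lam p n f = sumObs lam p n g := by
  induction n with
  | zero => exact ⟨{0}, fun f g hfg => by simp only [sumObs, hfg 0 (by simp)]⟩
  | succ n ih =>
    obtain ⟨F, hF⟩ := ih
    refine ⟨Finset.univ.biUnion fun j => F.image fun s => lam j + s, fun f g hfg => ?_⟩
    simp only [sumObs]
    refine Finset.sum_congr rfl fun j _ => ?_
    rw [hF (fun s => f (lam j + s)) (fun s => g (lam j + s)) fun s hs => hfg _ ?_]
    exact Finset.mem_biUnion.2 ⟨j, Finset.mem_univ _, Finset.mem_image_of_mem _ hs⟩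

variable [DecidableEq J]

/-- Orthogonality of the projections removes the cross terms at the first site, and the later sites
commute with it. -/
theorem sumObs_mul (h : IsSpectralDecomposition a lam p) (n : ℕ) (f g : ℝ → ℝ) :
    sumObs lam p n (f * g) = sumObs lam p n f * sumObs lam p n g := by
  induction n generalizing f g with
  | zero => simp only [sumObs, Pi.mul_apply, Complex.ofReal_mul, smul_mul_smul_comm, mul_one]
  | succ n ih =>
    simp only [sumObs]
    rw [Finset.sum_mul]
    refine Finset.sum_congr rfl fun j _ => ?_
    have hterm : ∀ i, site A 1 (p j) * shift A (sumObs lam p n fun s => f (lam j + s)) *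
        (site A 1 (p i) * shift A (sumObs lam p n fun s => g (lam i + s))) =
        site A 1 (p j * p i) * (shift A (sumObs lam p n fun s => f (lam j + s)) *
          shift A (sumObs lam p n fun s => g (lam i + s))) := fun i => by
      rw [map_mul, mul_assoc, ← mul_assoc (shift A _) (site A 1 (p i)),
        ← (commute_site_shift_sumObs n (p i) _).eq]
      simp only [mul_assoc]
    rw [Finset.mul_sum, Finset.sum_eq_single j]
    · rw [hterm, h.mul_eq, if_pos rfl, ← map_mul, ← ih]
      rfl
    · intro i _ hi
      rw [hterm, h.mul_eq, if_neg hi.symm, map_zero, zero_mul]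
    · simp

theorem sumObs_const (h : IsSpectralDecomposition a lam p) (n : ℕ) (r : ℝ) :
    sumObs lam p n (fun _ => r) = (r : ℂ) • 1 := by
  induction n with
  | zero => rfl
  | succ n ih =>
    simp only [sumObs]
    rw [ih, ← Finset.sum_mul, ← map_sum, h.sum_eq, map_one, one_mul, map_smul, map_one]

theorem star_sumObs (h : IsSpectralDecomposition a lam p) (n : ℕ) (f : ℝ → ℝ) :
    star (sumObs lam p n f) = sumObs lam p n f := by
  induction n generalizing f with
  | zero => simp [sumObs, star_smul]
  | succ n ih =>
    simp only [sumObs]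
    rw [star_sum]
    refine Finset.sum_congr rfl fun j _ => ?_
    rw [star_mul, ← map_star, ← map_star, ih, h.star_eq]
    exact (commute_site_shift_sumObs n (p j) _).eq.symm

theorem sumObs_id (h : IsSpectralDecomposition a lam p) (n : ℕ) :
    sumObs lam p n (fun s => s) = ∑ k ∈ Finset.range n, (shift A)^[k] (site A 1 a) := by
  induction n with
  | zero => simp [sumObs]
  | succ n ih =>
    have h1 : ∀ j, sumObs lam p n (fun s => lam j + s) =
        (lam j : ℂ) • 1 + sumObs lam p n fun s => s := fun j => by
      rw [← sumObs_const h n, ← sumObs_add]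
      rfl
    simp only [sumObs, h1, map_add, map_smul, map_one, mul_add, mul_smul_comm, mul_one]
    rw [Finset.sum_add_distrib, ← Finset.sum_mul, ← map_sum, h.sum_eq, map_one, one_mul, ih,
      Finset.sum_range_succ', map_sum, add_comm]
    congr 1
    · refine Finset.sum_congr rfl fun k _ => ?_
      rw [Function.iterate_succ_apply']
    · rw [Function.iterate_zero, id, h.eq_sum, map_sum]
      simp only [map_smul]

theorem cfc_sumObs (h : IsSpectralDecomposition a lam p) (n : ℕ) (f g : ℝ → ℝ) :
    cfc f (sumObs lam p n g) = sumObs lam p n (f ∘ g) := by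
  obtain ⟨F, hF⟩ := exists_finset_sumObs lam p n
  let X : (ℝ → ℝ) →ₐ[ℝ] chain A :=
    { toFun := sumObs lam p n
      map_one' := by
        have := sumObs_const h n 1
        rwa [Complex.ofReal_one, one_smul] at this
      map_mul' := sumObs_mul h n
      map_zero' := by
        have := sumObs_const h n 0
        rwa [Complex.ofReal_zero, zero_smul] at this
      map_add' := sumObs_add n
      commutes' := fun r => by
        rw [Algebra.algebraMap_eq_smul_one, Algebra.algebraMap_eq_smul_one, ← Complex.coe_smul]
        exact (congrArg _ (by ext; simp)).trans (sumObs_const h n r) }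
  exact cfc_algHom X F hF (h := g) (star_sumObs h n g) f

theorem ergodicAverage_eq (h : IsSpectralDecomposition a lam p) (n : ℕ) :
    ergodicAverage A a n = sumObs lam p n fun s => s / n := by
  rw [ergodicAverage, ← sumObs_id h]
  have h1 : (fun s : ℝ => s / n) = (n : ℝ)⁻¹ • fun s : ℝ => s := by
    ext s; simp [div_eq_inv_mul]
  rw [h1, sumObs_smul]
  push_cast
  rfl

end SumObs

/-! ### The distribution as a measure -/

section Law

variable {A B J : Type*} [Fintype J] [Ring A] [Algebra ℂ A] [Ring B] [Algebra ℂ B]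

/-- The measure `S ↦ φ (sumMap n 1_S 1)`, for a positive functional `φ`. -/
noncomputable def law (E : A ⊗[ℂ] B →ₗ[ℂ] B) (lam : J → ℝ) (p : J → A) :
    ℕ → (B →ₗ[ℂ] ℂ) → Measure ℝ
  | 0, φ => ENNReal.ofReal (φ 1).re • Measure.dirac 0
  | n + 1, φ => ∑ j, (law E lam p n (φ ∘ₗ partialMap E (p j))).map fun s => lam j + s

/-- The measure is assembled from Dirac masses, so countable additivity needs no proof; `hpos` lets
`ENNReal.ofReal` pass through the sum. -/
theorem law_apply [PartialOrder B] {E : A ⊗[ℂ] B →ₗ[ℂ] B} {lam : J → ℝ} {p : J → A}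
    (hp : ∀ j, IsPositiveMap (partialMap E (p j)))
    (hpos : ∀ (n : ℕ) (S : Set ℝ), 0 ≤ sumMap E lam p n (S.indicator 1) 1)
    (n : ℕ) {φ : B →ₗ[ℂ] ℂ} (hφ : IsPositiveMap φ) {S : Set ℝ} (hS : MeasurableSet S) :
    law E lam p n φ S = ENNReal.ofReal (φ (sumMap E lam p n (S.indicator 1) 1)).re := by
  induction n generalizing φ S with
  | zero =>
    simp only [law, sumMap, Measure.smul_apply, smul_eq_mul]
    rw [Measure.dirac_apply' _ hS]
    by_cases h0 : (0 : ℝ) ∈ S <;> simp [h0]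
  | succ n ih =>
    have hm : ∀ j, Measurable fun s : ℝ => lam j + s := fun j => measurable_const_add _
    have hφj : ∀ j, IsPositiveMap (φ ∘ₗ partialMap E (p j)) := fun j b hb => hφ _ (hp j b hb)
    simp only [law, sumMap, Measure.finsetSum_apply, LinearMap.sum_apply, map_sum, Complex.re_sum]
    rw [ENNReal.ofReal_sum_of_nonneg]
    · refine Finset.sum_congr rfl fun j _ => ?_
      rw [Measure.map_apply (hm j) hS, ih (hφj j) (hm j hS)]
      rfl
    · intro j _
      exact (hφj j).re_nonneg (hpos n ((fun s => lam j + s) ⁻¹' S))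

end Law

/-! ### The sums form a mixing family -/

section Family

/-- The expectation of functions of the sum of the copies of `∑ lam j • p j` at the sites
`1, …, n`. -/
noncomputable def sumLaw {A B J : Type*} [Fintype J] [Ring A] [Algebra ℂ A] [Ring B] [Algebra ℂ B]
    (E : A ⊗[ℂ] B →ₗ[ℂ] B) (ρ : B →ₗ[ℂ] ℂ) (lam : J → ℝ) (p : J → A)
    (n : ℕ) : (ℝ → ℝ) →ₗ[ℝ] ℝ where
  toFun f := (ρ (sumMap E lam p n f 1)).re
  map_add' f g := by rw [sumMap_add, LinearMap.add_apply, map_add, Complex.add_re]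
  map_smul' r f := by
    rw [sumMap_smul, LinearMap.smul_apply, map_smul, smul_eq_mul, Complex.re_ofReal_mul]
    rfl

variable {ι B J : Type*} [Fintype ι] [DecidableEq ι] [Fintype J] [DecidableEq J] [CStarAlgebra B]
  [PartialOrder B] [StarOrderedRing B] {A : StarSubalgebra ℂ (Matrix ι ι ℂ)}
  {E : A ⊗[ℂ] B →ₗ[ℂ] B} {ρ : B →ₗ[ℂ] ℂ} {ω : chain A →ₗ[ℂ] ℂ} {a : A} {lam : J → ℝ} {p : J → A}

theorem IsSpectralDecomposition.isPositiveMap (h : IsSpectralDecomposition a lam p)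
    (hE : IsCompletelyPositive E) (j : J) : IsPositiveMap (partialMap E (p j)) := by
  have := isPositiveMap_partialMap hE (p j)
  rwa [h.star_eq, h.mul_eq, if_pos rfl] at this

/-- `exists_mixing` bounds a sum over the gaps k < K, and an ergodic state may be periodic, so a
single gap need not do. Each summand is at most the probability for the common length n + m + K: the
k gap sites and the K - k padding sites move the sum by at most K * D. Division by K gives the
constant c / K. -/
theorem exists_isMixingFamily [FiniteDimensional ℂ B] (hE : IsGeneratingTriple E ρ)
    (hω : IsGeneratedBy A E ρ ω) (herg : IsErgodic A ω) (h : IsSpectralDecomposition a lam p) :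
    ∃ D K c, IsMixingFamily (sumLaw E ρ lam p) D K c := by
  have hp := h.isPositiveMap hE.completelyPositive
  have hρ := hE.isState.isPositiveMap
  -- The summand 1 keeps D positive when all eigenvalues vanish.
  set D : ℝ := ∑ j, |lam j| + 1 with hDdef
  have hD : ∀ j, |lam j| ≤ D := fun j => by
    have : |lam j| ≤ ∑ j, |lam j| := Finset.single_le_sum (f := fun j => |lam j|)
      (fun i _ => abs_nonneg _) (Finset.mem_univ j)
    linarith
  have hD0 : 0 < D := by
    have : 0 ≤ ∑ j, |lam j| := Finset.sum_nonneg fun j _ => abs_nonneg _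
    linarith
  obtain ⟨K, hK, c, hc, hmix⟩ := exists_mixing hE hω herg
  have hK' : (0 : ℝ) < K := by exact_mod_cast hK
  have hle : ∀ {b b' : B}, 0 ≤ b' - b → (ρ b).re ≤ (ρ b').re := fun {b b'} hb => by
    have := hρ.re_nonneg hb
    rw [map_sub, Complex.sub_re] at this
    linarith
  have hpad : ∀ (n k : ℕ) (α β : ℝ), sumLaw E ρ lam p n (window α β) ≤
      sumLaw E ρ lam p (n + k) (window α (β + k * D)) := fun n k α β => by
    refine hle ?_
    have h1 := isPositiveMap_sumMap_sub_mul hp hD n k (f := window α β) (g := 1)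
      (h := window α (β + k * D)) (fun s s' _ hs' => window_mul_one_le hs') 1 zero_le_one
    rwa [LinearMap.sub_apply, Module.End.mul_apply, sumMap_one _ _ _ h.sum_eq,
      partialMap_one_pow_apply_one hE] at h1
  have hwpos : ∀ (n : ℕ) (α β : ℝ), IsPositiveMap (sumMap E lam p n (window α β)) := fun n α β =>
    isPositiveMap_sumMap hp hD n fun s _ => window_nonneg _ _ _
  refine ⟨D, K, c / K, hD0, by positivity, fun n f g hfg => ?_, fun n => ?_,
    fun n m α α' β β' => ?_, hpad⟩
  · refine hle ?_
    have := isPositiveMap_sumMap_sub hp hD n hfg 1 zero_le_one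
    rwa [LinearMap.sub_apply] at this
  · change (ρ (sumMap E lam p n 1 1)).re = 1
    rw [sumMap_one _ _ _ h.sum_eq, partialMap_one_pow_apply_one hE, hE.isState.map_one,
      Complex.one_re]
  · have hidem : window α' β' * window α' β' = window α' β' := by
      ext s
      rcases le_or_gt |s - α'| β' with hs | hs
      · rw [Pi.mul_apply, window_of_abs_le hs, mul_one]
      · rw [Pi.mul_apply, window_of_lt_abs hs, mul_zero]
    have hm := hmix n m _ _ (sumObs_mem_localPairs E n (window α β))
      (sumObs_mem_localPairs E m (window α' β')) (hwpos _ _ _) (hwpos _ _ _) (star_sumObs h _ _)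
      (by rw [← sumObs_mul h, hidem])
    have hterm : ∀ k ∈ Finset.range K, (ρ (sumMap E lam p n (window α β)
        ((partialMap E 1 ^ k) (sumMap E lam p m (window α' β') 1)))).re ≤
        sumLaw E ρ lam p (n + m + K) (window (α + α') (β + β' + K * D)) := fun k hk => by
      set y := sumMap E lam p m (window α' β') 1 with hy
      have hy0 : 0 ≤ y := hwpos _ _ _ 1 zero_le_one
      have h1 := isPositiveMap_sumMap_sub_mul hp hD n k (f := window α β) (g := 1)
        (h := window α (β + k * D)) (fun s s' _ hs' => window_mul_one_le hs') y hy0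
      rw [LinearMap.sub_apply, Module.End.mul_apply, sumMap_one _ _ _ h.sum_eq] at h1
      have h2 := isPositiveMap_sumMap_sub_mul hp hD (n + k) m (f := window α (β + k * D))
        (g := window α' β') (h := window (α + α') (β + k * D + β'))
        (fun s s' _ _ => window_mul_window_le _ _ _ _ _ _) 1 zero_le_one
      rw [LinearMap.sub_apply, Module.End.mul_apply] at h2
      have h3 := hpad (n + k + m) (K - k) (α + α') (β + k * D + β')
      have hkK : k ≤ K := (Finset.mem_range.1 hk).le
      have e1 : n + k + m + (K - k) = n + m + K := by omega
      have e2 : β + k * D + β' + ((K - k : ℕ) : ℝ) * D = β + β' + K * D := by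
        rw [Nat.cast_sub hkK]; ring
      rw [e1, e2] at h3
      exact (hle h1).trans ((hle h2).trans h3)
    have hs := hm.trans (Finset.sum_le_card_nsmul _ _ _ hterm)
    rw [Finset.card_range, nsmul_eq_mul] at hs
    rw [div_mul_eq_mul_div, div_mul_eq_mul_div, div_le_iff₀ hK', mul_comm _ (K : ℝ)]
    exact hs

end Family

/-! ### The Legendre transform and the large deviation principle -/

/-- A supremum of affine functions is convex and lower semicontinuous; t = 0 gives non-negativity,
and t = 1, t = -1 bound the level sets. -/
theorem isGoodRateFunction_legendre {Λ : ℝ → ℝ} (h0 : Λ 0 = 0) :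
    IsGoodRateFunction fun x => ⨆ t : ℝ, ((t * x - Λ t : ℝ) : EReal) := by
  have hlsc : LowerSemicontinuous fun x : ℝ => ⨆ t : ℝ, ((t * x - Λ t : ℝ) : EReal) :=
    lowerSemicontinuous_iSup fun t => Continuous.lowerSemicontinuous
      (continuous_coe_real_ereal.comp (by fun_prop))
  refine ⟨fun x => ?_, fun x y s t hs ht hst => ?_, hlsc, fun c => ?_⟩
  · refine le_trans ?_ (le_iSup _ (0 : ℝ))
    simp [h0]
  · refine iSup_le fun u => ?_
    have e : u * (s * x + t * y) - Λ u = s * (u * x - Λ u) + t * (u * y - Λ u) := by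
      linear_combination Λ u * hst
    rw [e, EReal.coe_add, EReal.coe_mul, EReal.coe_mul]
    refine add_le_add ?_ ?_
    · exact mul_le_mul_of_nonneg_left (le_iSup (fun t : ℝ => ((t * x - Λ t : ℝ) : EReal)) u)
        (EReal.coe_nonneg.2 hs)
    · exact mul_le_mul_of_nonneg_left (le_iSup (fun t : ℝ => ((t * y - Λ t : ℝ) : EReal)) u)
        (EReal.coe_nonneg.2 ht)
  · refine (isCompact_Icc (a := -(c + Λ (-1))) (b := c + Λ 1)).of_isClosed_subset
      (hlsc.isClosed_preimage c) fun x hx => ?_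
    have h1 : ∀ t : ℝ, t * x - Λ t ≤ c := fun t =>
      EReal.coe_le_coe_iff.1 ((le_iSup (fun t : ℝ => ((t * x - Λ t : ℝ) : EReal)) t).trans hx)
    constructor
    · linarith [h1 (-1)]
    · linarith [h1 1]

/-- The large deviation principle for the averages of a mixing family. -/
theorem IsMixingFamily.largeDeviationPrinciple {m : ℕ → (ℝ → ℝ) →ₗ[ℝ] ℝ} {D c : ℝ} {K : ℕ}
    (h : IsMixingFamily m D K c) {Λ : ℝ → ℝ}
    (hΛ : ∀ t, Tendsto (fun n : ℕ => Real.log (m n fun s => Real.exp (t * s)) / n) atTop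
      (nhds (Λ t))) {μ : ℕ → Measure ℝ}
    (hμ : ∀ (n : ℕ) (S : Set ℝ), MeasurableSet S →
      μ n S = ENNReal.ofReal (m n fun s => S.indicator 1 (s / n))) :
    LargeDeviationPrinciple μ fun x => ⨆ t : ℝ, ((t * x - Λ t : ℝ) : EReal) := by
  have hlog : ∀ (n : ℕ) (z : ℝ), 0 < n → (((n : ℝ)⁻¹ : ℝ) : EReal) *
      ENNReal.log (ENNReal.ofReal (Real.exp (n * z))) = z := fun n z hn => by
    have hn' : (n : ℝ) ≠ 0 := by exact_mod_cast hn.ne'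
    rw [ENNReal.log_ofReal_of_pos (Real.exp_pos _), Real.log_exp, ← EReal.coe_mul,
      inv_mul_cancel_left₀ hn']
  have hinv : ∀ n : ℕ, (0 : EReal) ≤ (((n : ℝ)⁻¹ : ℝ) : EReal) := fun n =>
    EReal.coe_nonneg.2 (by positivity)
  intro H hH
  constructor
  · rw [EReal.neg_le]
    refine le_iInf₂ fun x hx => ?_
    rw [EReal.neg_le]
    change -(⨆ t : ℝ, ((t * x - Λ t : ℝ) : EReal)) ≤ _
    rcases eq_or_ne (⨆ t : ℝ, ((t * x - Λ t : ℝ) : EReal)) ⊤ with hI | hI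
    · rw [hI, EReal.neg_top]; exact bot_le
    have hbot : (⨆ t : ℝ, ((t * x - Λ t : ℝ) : EReal)) ≠ ⊥ := fun hb => by
      have := (le_iSup (fun t : ℝ => ((t * x - Λ t : ℝ) : EReal)) 0).trans hb.le
      exact EReal.coe_ne_bot _ (le_bot_iff.1 this)
    lift (⨆ t : ℝ, ((t * x - Λ t : ℝ) : EReal)) to ℝ using ⟨hI, hbot⟩ with s hs
    have hmem := h.mem_epigraph hΛ (x := x) (s := s) fun t => by
      rw [← EReal.coe_le_coe_iff, hs]
      exact le_iSup (fun t : ℝ => ((t * x - Λ t : ℝ) : EReal)) t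
    obtain ⟨δ, hδ, hball⟩ := Metric.isOpen_iff.1 isOpen_interior x hx
    refine EReal.ge_of_forall_gt_iff_ge.1 fun z hz => ?_
    rw [← EReal.coe_neg, EReal.coe_lt_coe_iff] at hz
    refine le_liminf_of_le (by isBoundedDefault) ?_
    -- The slack -s - z turns the exponent s + ε into -z; the window of half-width n δ / 2 lies in
    -- the rescaled ball inside H.
    filter_upwards [hmem (δ / 2) (by positivity) (-s - z) (by linarith),
      eventually_gt_atTop 0] with n hn hn0
    have hn0' : (0 : ℝ) < n := by exact_mod_cast hn0
    rw [← hlog n z hn0]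
    refine mul_le_mul_of_nonneg_left (ENNReal.log_monotone ?_) (hinv n)
    rw [hμ n H hH]
    refine ENNReal.ofReal_le_ofReal ?_
    have e : -((n : ℝ) * (s + (-s - z))) = n * z := by ring
    simp only [e] at hn
    refine hn.trans (h.mono _ _ _ fun y _ => ?_)
    rcases le_or_gt |y - n * x| (n * (δ / 2)) with hy | hy
    · rw [window_of_abs_le hy, Set.indicator_of_mem]
      · rfl
      · refine interior_subset (hball ?_)
        rw [Metric.mem_ball, Real.dist_eq]
        have e2 : y / n - x = (y - n * x) / n := by field_simp
        rw [e2, abs_div, abs_of_pos hn0', div_lt_iff₀ hn0']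
        nlinarith
    · rw [window_of_lt_abs hy]
      exact Set.indicator_nonneg (fun _ _ => zero_le_one) _
  · rw [EReal.le_neg]
    refine EReal.ge_of_forall_gt_iff_ge.1 fun z hz => ?_
    obtain ⟨b, hzb, hb⟩ := EReal.lt_iff_exists_real_btwn.1 hz
    rw [EReal.coe_lt_coe_iff] at hzb
    have hF : ∀ x ∈ closure H, ∃ t, b < t * x - Λ t := fun x hx => by
      obtain ⟨t, ht⟩ := lt_iSup_iff.1 (hb.trans_le (iInf₂_le x hx))
      exact ⟨t, EReal.coe_lt_coe_iff.1 ht⟩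
    rw [EReal.le_neg, ← EReal.coe_neg]
    refine limsup_le_of_le (by isBoundedDefault) ?_
    filter_upwards [h.eventually_indicator_le hΛ isClosed_closure hF (sub_pos.2 hzb),
      eventually_gt_atTop 0] with n hn hn0
    rw [← hlog n (-z) hn0]
    refine mul_le_mul_of_nonneg_left (ENNReal.log_monotone ?_) (hinv n)
    refine (measure_mono subset_closure).trans ?_
    rw [hμ n _ isClosed_closure.measurableSet]
    refine ENNReal.ofReal_le_ofReal (hn.trans (le_of_eq ?_))
    congr 1
    ring

end SpinChain

/-! ### The finitely correlated state -/

open SpinChain in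
/-- The large deviation principle for the ergodic averages of a one-site observable in an ergodic
finitely correlated state. -/
theorem theorem3p1 {ι B : Type*} [Fintype ι] [DecidableEq ι] [CStarAlgebra B]
    [FiniteDimensional ℂ B]
    (A : StarSubalgebra ℂ (Matrix ι ι ℂ))
    (E : A ⊗[ℂ] B →ₗ[ℂ] B) (ρ : B →ₗ[ℂ] ℂ) (hE : SpinChain.IsGeneratingTriple E ρ)
    (ω : SpinChain.chain A →ₗ[ℂ] ℂ) (hω : SpinChain.IsGeneratedBy A E ρ ω)
    (herg : SpinChain.IsErgodic A ω) (a : A) (ha : IsSelfAdjoint a) :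
    ∃ μ : ℕ → Measure ℝ,
      (∀ n : ℕ, 0 < n → SpinChain.IsDistribution ω (SpinChain.ergodicAverage A a n) (μ n)) ∧
      SpinChain.IsGoodRateFunction (SpinChain.rateFunction E a) ∧
      SpinChain.LargeDeviationPrinciple μ (SpinChain.rateFunction E a) := by
  let _ := CStarAlgebra.spectralOrder B
  have := CStarAlgebra.spectralOrderedRing B
  obtain ⟨s, p, h⟩ := exists_isSpectralDecomposition ha
  set lam : s → ℝ := fun j => j with hlam
  obtain ⟨D, K, c, hfam⟩ := exists_isMixingFamily hE hω herg h
  have hp := h.isPositiveMap hE.completelyPositive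
  have hρ := hE.isState.isPositiveMap
  have hpos : ∀ (n : ℕ) (f : ℝ → ℝ), (∀ x, 0 ≤ f x) → 0 ≤ sumMap E lam p n f 1 := fun n f hf =>
    isPositiveMap_sumMap (D := ∑ j, |lam j|) hp (fun j => Finset.single_le_sum
      (f := fun j => |lam j|) (fun i _ => abs_nonneg _) (Finset.mem_univ j)) n
      (fun x _ => hf x) 1 zero_le_one
  have hind : ∀ (S : Set ℝ) (x : ℝ), 0 ≤ S.indicator (1 : ℝ → ℝ) x := fun S x =>
    Set.indicator_nonneg (fun _ _ => zero_le_one) _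
  have hexp : ∀ (n : ℕ) (t : ℝ), sumMap E lam p n (fun x => Real.exp (t * x)) =
      partialMap E (NormedSpace.exp ((t : ℂ) • a)) ^ n := fun n t => by
    rw [sumMap_exp, h.exp_eq, partialMap_sum]
    simp only [partialMap_smul]
  have hΛ : ∀ t, Tendsto (fun n : ℕ =>
      Real.log (sumLaw E ρ lam p n fun x => Real.exp (t * x)) / n) atTop
      (nhds (Real.log (expRadius E a t))) := fun t => by
    have hΦ : IsPositiveMap (partialMap E (NormedSpace.exp ((t : ℂ) • a))) := by
      rw [h.exp_eq, partialMap_sum]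
      refine IsPositiveMap.sum fun j _ => ?_
      rw [partialMap_smul]
      exact (hp j).smul (Real.exp_pos _).le
    -- The increments being bounded by D, the moments are at least exp(-|t| D)ⁿ, which is the
    -- required geometric lower bound.
    refine (tendsto_log_div_spectralRadius hE.isState hE.faithful hΦ
      (Real.exp_pos (-(|t| * D))) fun n => ?_).congr fun n => ?_
    · rw [← hexp, ← Real.exp_nat_mul, mul_neg]
      exact hfam.exp_le n t
    · rw [← hexp]
      rfl
  -- At t = 0 every moment equals 1, so uniqueness of limits gives the value without computing a
  -- spectral radius.
  have hΛ0 : Real.log (expRadius E a 0) = 0 := by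
    refine tendsto_nhds_unique (hΛ 0) (tendsto_const_nhds.congr fun n => ?_)
    have e : (fun x : ℝ => Real.exp (0 * x)) = 1 := by ext; simp
    rw [e, hfam.one, Real.log_one, zero_div]
  set μ : ℕ → Measure ℝ := fun n => (law E lam p n ρ).map fun x => x / n with hμdef
  have hμ : ∀ (n : ℕ) (S : Set ℝ), MeasurableSet S →
      μ n S = ENNReal.ofReal (sumLaw E ρ lam p n fun x => S.indicator 1 (x / n)) :=
    fun n S hS => by
      have hm : Measurable fun x : ℝ => x / n := measurable_id.div_const _
      rw [hμdef, Measure.map_apply hm hS,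
        law_apply hp (fun n S => hpos n _ (hind S)) n hρ (hm hS)]
      rfl
  refine ⟨μ, fun n _ => ⟨⟨?_⟩, fun S hS => ?_⟩, isGoodRateFunction_legendre hΛ0,
    hfam.largeDeviationPrinciple hΛ hμ⟩
  · rw [hμ n _ MeasurableSet.univ]
    simp only [Set.indicator_univ]
    exact (congrArg ENNReal.ofReal (hfam.one n)).trans ENNReal.ofReal_one
  · have hnn := hpos n (fun x => S.indicator 1 (x / n)) fun x => hind S _
    have hnn' : 0 ≤ sumLaw E ρ lam p n fun x => S.indicator 1 (x / n) := hρ.re_nonneg hnn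
    rw [measureReal_def, hμ n S hS, ENNReal.toReal_ofReal hnn',
      ergodicAverage_eq h, cfc_sumObs h,
      apply_of_mem_localPairs hω (sumObs_mem_localPairs E n _)]
    exact hρ.ofReal_re hnn
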